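/- For a convex body $C\subset\mathbb R^n$ let $vr(C)=\big(|C|/|\mathcal E|\big)^{1/n}$, where $|\cdot|$ denotes volume and $\mathcal E$ is the ellipsoid of maximal volume included in $C$. For an $n$-dimensional real normed space $X$ let $vr(X)=vr(C)$, where $C\subset\mathbb R^n$ is the unit ball of $X$ in any linear representation of $X$ on $\mathbb R^n$ (the value does not depend on the representation). **Theorem 6.** Let $1\le p\le\infty$ and let $n$ be a positive integer. Among $n$-dimensional subspaces of (real) $L_p$, the space $\ell_p^n$ has exactly maximal volume ratio. That is, for every measure space $(\Omega,\mu)$ and every $n$-dimensional linear subspace $X$ of $L_p(\Omega,\mu)$, $$vr(X)\le vr(\ell_p^n),$$ and the maximum is attained already in $L_p[0,1]$, which has a subspace isometric to $\ell_p^n$. -/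

import Mathlib

open MeasureTheory Set
open scoped ENNReal

/-- A (nondegenerate) ellipsoid in `ℝⁿ`: the image of the closed Euclidean unit ball under an
invertible affine map. -/
def IsEllipsoid {n : ℕ} (E : Set (EuclideanSpace ℝ (Fin n))) : Prop :=
  ∃ A : EuclideanSpace ℝ (Fin n) ≃ᵃ[ℝ] EuclideanSpace ℝ (Fin n),
    E = A '' Metric.closedBall 0 1

/-- `E` is an ellipsoid of maximal volume included in `C`. -/
def IsMaximalEllipsoid {n : ℕ} (C E : Set (EuclideanSpace ℝ (Fin n))) : Prop :=
  IsEllipsoid E ∧ E ⊆ C ∧ ∀ F, IsEllipsoid F → F ⊆ C → volume F ≤ volume E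

/-- The largest volume of an ellipsoid included in `C`.  It is written as a supremum; for a convex
body the supremum is attained, see `exists_isMaximalEllipsoid`. -/
noncomputable def maxEllipsoidVolume {n : ℕ} (C : Set (EuclideanSpace ℝ (Fin n))) : ℝ≥0∞ :=
  ⨆ (E : Set (EuclideanSpace ℝ (Fin n))) (_ : IsEllipsoid E ∧ E ⊆ C), volume E

/-- The volume ratio `(|C| / |E|) ^ (1 / n)` of a body `C` in `ℝⁿ`, where `E` is the ellipsoid of
maximal volume included in `C`. -/
noncomputable def bodyVolumeRatio {n : ℕ} (C : Set (EuclideanSpace ℝ (Fin n))) : ℝ≥0∞ :=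
  (volume C / maxEllipsoidVolume C) ^ (1 / (n : ℝ))

/-- The volume ratio of a finite-dimensional real normed space: the volume ratio of its unit ball
in a representation of the space on `ℝⁿ`.  The choice of the representation does not matter, see
`volumeRatio_eq`. -/
noncomputable def volumeRatio (X : Type*) [NormedAddCommGroup X] [NormedSpace ℝ X]
    [FiniteDimensional ℝ X] : ℝ≥0∞ :=
  bodyVolumeRatio ((toEuclidean : X ≃L[ℝ] EuclideanSpace ℝ (Fin (Module.finrank ℝ X))) ''
    Metric.closedBall (0 : X) 1)

/-- The `n`-dimensional real space `ℓ_p^n`. -/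
abbrev EllP (p : ℝ≥0∞) (n : ℕ) : Type := PiLp p (fun _ : Fin n => ℝ)

theorem maxEllipsoidVolume_eq {n : ℕ} {C E : Set (EuclideanSpace ℝ (Fin n))}
    (h : IsMaximalEllipsoid C E) : maxEllipsoidVolume C = volume E :=
  le_antisymm (iSup₂_le fun F hF => h.2.2 F hF.1 hF.2)
    (le_iSup₂_of_le (f := fun (F : Set (EuclideanSpace ℝ (Fin n))) (_ : IsEllipsoid F ∧ F ⊆ C) =>
      volume F) E ⟨h.1, h.2.1⟩ le_rfl)

theorem bodyVolumeRatio_eq {n : ℕ} {C E : Set (EuclideanSpace ℝ (Fin n))}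
    (h : IsMaximalEllipsoid C E) : bodyVolumeRatio C = (volume C / volume E) ^ (1 / (n : ℝ)) := by
  rw [bodyVolumeRatio, maxEllipsoidVolume_eq h]

/-- A compact set with nonempty interior includes an ellipsoid of maximal volume. -/
theorem exists_isMaximalEllipsoid {n : ℕ} {C : Set (EuclideanSpace ℝ (Fin n))}
    (hC : IsCompact C) (hi : (interior C).Nonempty) : ∃ E, IsMaximalEllipsoid C E := by
  let V := EuclideanSpace ℝ (Fin n)
  let S : Set (V × (V →L[ℝ] V)) :=
    {q | ∀ x ∈ Metric.closedBall (0 : V) 1, q.1 + q.2 x ∈ C}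
  have hvol (q : V × (V →L[ℝ] V)) :
      volume ((fun x => q.1 + q.2 x) '' Metric.closedBall (0 : V) 1) =
        ENNReal.ofReal |q.2.det| * volume (Metric.closedBall (0 : V) 1) := by
    have : (fun x => q.1 + q.2 x) '' Metric.closedBall (0 : V) 1 =
        (fun y => q.1 + y) '' (q.2 '' Metric.closedBall (0 : V) 1) := by
      rw [image_image]
    rw [this, image_add_left, measure_preimage_add, Measure.addHaar_image_continuousLinearMap]
  have hell (E : Set V) (hE : IsEllipsoid E) : ∃ q : V × (V →L[ℝ] V), q.2.det ≠ 0 ∧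
      E = (fun x => q.1 + q.2 x) '' Metric.closedBall (0 : V) 1 := by
    obtain ⟨A, rfl⟩ := hE
    refine ⟨(A 0, (A.linear.toContinuousLinearEquiv : V →L[ℝ] V)), ?_, ?_⟩
    · exact A.linear.isUnit_det'.ne_zero
    · refine image_congr fun x _ => ?_
      have := A.map_vadd 0 x
      simp only [vadd_eq_add, add_zero] at this
      rw [this, add_comm]
      rfl
  have hcl : IsClosed S := by
    have : S = ⋂ x ∈ Metric.closedBall (0 : V) 1,
        (fun q : V × (V →L[ℝ] V) => q.1 + q.2 x) ⁻¹' C := by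
      ext q; simp [S]
    rw [this]
    refine isClosed_biInter fun x _ => hC.isClosed.preimage ?_
    fun_prop
  have hbd : Bornology.IsBounded S := by
    obtain ⟨R, hR⟩ := hC.isBounded.exists_norm_le
    refine (isBounded_iff_forall_norm_le).2 ⟨2 * R, fun q hq => ?_⟩
    have h0 : ‖q.1‖ ≤ R := by
      simpa using hR _ (hq 0 (by simp))
    have hR0 : 0 ≤ R := (norm_nonneg _).trans h0
    refine max_le (by linarith) ?_
    refine q.2.opNorm_le_of_unit_norm (by linarith) fun x hx => ?_
    have h1 : ‖q.1 + q.2 x‖ ≤ R := hR _ (hq x (by simp [hx]))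
    calc ‖q.2 x‖ = ‖(q.1 + q.2 x) - q.1‖ := by simp
      _ ≤ ‖q.1 + q.2 x‖ + ‖q.1‖ := norm_sub_le _ _
      _ ≤ 2 * R := by linarith
  have hcp : IsCompact S := Metric.isCompact_of_isClosed_isBounded hcl hbd
  obtain ⟨a, ha⟩ := hi
  obtain ⟨r, hr, hrC⟩ := Metric.nhds_basis_closedBall.mem_iff.1 (mem_interior_iff_mem_nhds.1 ha)
  let q₀ : V × (V →L[ℝ] V) := (a, r • ContinuousLinearMap.id ℝ V)
  have hq₀ : q₀ ∈ S := fun x hx => hrC <| by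
    have : ‖x‖ ≤ 1 := by simpa using hx
    simp only [q₀, Metric.mem_closedBall, dist_self_add_left]
    simp [norm_smul, abs_of_pos hr]
    nlinarith
  have hd₀ : q₀.2.det ≠ 0 := by
    simp only [q₀, ContinuousLinearMap.det]
    simp [LinearMap.det_smul, hr.ne']
  have hcont : ContinuousOn (fun q : V × (V →L[ℝ] V) => |q.2.det|) S :=
    (ContinuousLinearMap.continuous_det.comp continuous_snd).abs.continuousOn
  obtain ⟨q, hqS, hq⟩ := hcp.exists_isMaxOn ⟨q₀, hq₀⟩ hcont
  have hqd : q.2.det ≠ 0 := by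
    have h1 : |q₀.2.det| ≤ |q.2.det| := hq hq₀
    exact abs_pos.1 ((abs_pos.2 hd₀).trans_le h1)
  refine ⟨(fun x => q.1 + q.2 x) '' Metric.closedBall (0 : V) 1, ?_, ?_, ?_⟩
  · let L : V ≃ₗ[ℝ] V := LinearEquiv.ofIsUnitDet (f := (q.2 : V →ₗ[ℝ] V))
      (v := Module.finBasis ℝ V) (v' := Module.finBasis ℝ V)
      (by rw [LinearMap.det_toMatrix]; exact hqd.isUnit)
    refine ⟨L.toAffineEquiv.trans (AffineEquiv.constVAdd ℝ V q.1), ?_⟩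
    refine image_congr fun x _ => ?_
    rfl
  · rintro _ ⟨x, hx, rfl⟩
    exact hqS x hx
  · intro F hF hFC
    obtain ⟨t, -, rfl⟩ := hell F hF
    have ht : t ∈ S := fun x hx => hFC ⟨x, hx, rfl⟩
    have h1 : |t.2.det| ≤ |q.2.det| := hq ht
    rw [hvol, hvol]
    exact mul_le_mul_left (ENNReal.ofReal_le_ofReal h1) _

/-- The volume ratio of a body is invariant under invertible linear maps. -/
theorem bodyVolumeRatio_image {n : ℕ}
    (T : EuclideanSpace ℝ (Fin n) ≃ₗ[ℝ] EuclideanSpace ℝ (Fin n))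
    (C : Set (EuclideanSpace ℝ (Fin n))) : bodyVolumeRatio (T '' C) = bodyVolumeRatio C := by
  have key (T : EuclideanSpace ℝ (Fin n) ≃ₗ[ℝ] EuclideanSpace ℝ (Fin n))
      (s : Set (EuclideanSpace ℝ (Fin n))) :
      volume (T '' s) = ENNReal.ofReal |LinearMap.det T.toLinearMap| * volume s :=
    Measure.addHaar_image_linearMap volume T.toLinearMap s
  have hell (T : EuclideanSpace ℝ (Fin n) ≃ₗ[ℝ] EuclideanSpace ℝ (Fin n))
      (E : Set (EuclideanSpace ℝ (Fin n))) (hE : IsEllipsoid E) : IsEllipsoid (T '' E) := by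
    obtain ⟨A, rfl⟩ := hE
    exact ⟨A.trans T.toAffineEquiv, by rw [image_image]; rfl⟩
  set d := ENNReal.ofReal |LinearMap.det T.toLinearMap| with hd
  have hd0 : d ≠ 0 := by
    simpa [hd] using T.isUnit_det'.ne_zero
  have hdt : d ≠ ∞ := ENNReal.ofReal_ne_top
  have hm : maxEllipsoidVolume (T '' C) = d * maxEllipsoidVolume C := by
    simp only [maxEllipsoidVolume, ENNReal.mul_iSup]
    apply le_antisymm
    · refine iSup₂_le fun E hE => ?_
      have hEE : T '' (T.symm '' E) = E := by simp [image_image]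
      refine le_iSup₂_of_le (T.symm '' E) ⟨hell _ _ hE.1, ?_⟩ ?_
      · rintro _ ⟨y, hy, rfl⟩
        obtain ⟨x, hx, rfl⟩ := hE.2 hy
        simpa using hx
      · rw [← key, hEE]
    · refine iSup₂_le fun E hE => ?_
      refine le_iSup₂_of_le (T '' E) ⟨hell _ _ hE.1, image_mono hE.2⟩ ?_
      rw [key]
  rw [bodyVolumeRatio, bodyVolumeRatio, hm, key, ENNReal.mul_div_mul_left _ _ hd0 hdt]

/-- The volume ratio of a space may be computed in any representation of the space on `ℝⁿ`. -/
theorem volumeRatio_eq {X : Type*} [NormedAddCommGroup X] [NormedSpace ℝ X]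
    [FiniteDimensional ℝ X] {n : ℕ} (e : X ≃ₗ[ℝ] EuclideanSpace ℝ (Fin n)) :
    volumeRatio X = bodyVolumeRatio (e '' Metric.closedBall (0 : X) 1) := by
  obtain rfl : Module.finrank ℝ X = n := by simpa using e.finrank_eq
  have h := bodyVolumeRatio_image
    ((toEuclidean : X ≃L[ℝ] EuclideanSpace ℝ (Fin (Module.finrank ℝ X))).toLinearEquiv.symm.trans e)
    ((toEuclidean : X ≃L[ℝ] EuclideanSpace ℝ (Fin (Module.finrank ℝ X))) ''
      Metric.closedBall (0 : X) 1)
  rw [volumeRatio, ← h, image_image]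
  congr 1
  refine image_congr fun x _ => ?_
  simp

/-! For finite `p`, write the norm of `X` in coordinates as `‖x‖ ^ p = ∫ |⟪f, x⟫| ^ p dμ`. Lewis'
theorem (`exists_isIsotropic_integral_inner_rpow`) changes position and density so that it becomes
`∫ |⟪u, x⟫| ^ p dν`, with unit vectors `u` and `∫ u ⊗ u dν = id`. In this position the volume and
the inscribed ellipsoid can be estimated separately, and both estimates are sharp for `ℓ_p^n`.

Volume: `Γ(n/p + 1)` times the volume of the unit ball is `∫ exp (-‖x‖ ^ p) dx`, whose integrand is
`exp ∫ log f(⟪u, x⟫) dν` for `f(t) = exp (-|t| ^ p)`. The Brascamp-Lieb inequality for isotropic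
measures (`lintegral_exp_integral_log_le`) bounds it by `(∫ f) ^ n`, the value for `ℓ_p^n`. It is
proved by transport: the monotone map `T` from `f` to a Gaussian of equal mass gives `Θ x = ∫ T(⟪u,
x⟫) u dν`, which is injective; Ball's determinant inequality bounds its Jacobian from below, and the
change of variables `y = Θ x` leaves a Gaussian integral.

Ellipsoid: the Euclidean ball of radius `n ^ (1/2 - 1/min p 2)` lies in the unit ball
(`integral_rpow_le_one_of_norm_le`). Conversely, by Hadamard's inequality no ellipsoid in the ball
of `ℓ_p^n` has larger volume (`maxEllipsoidVolume_ellP_le`).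

For `p = ∞` no representation is needed: every `n`-dimensional space is, up to a factor `θ < 1`, a
subspace of some `ℓ_q^m` with `q` large. The finite case applies there, and `θ → 1`. The copy of
`ℓ_p^n` in `L_p[0,1]` consists of step functions on `n` equal intervals. -/

/-! ### Monotone transport on the line -/

open Filter Topology in
theorem range_integral_Iic {f : ℝ → ℝ} (hf : Continuous f) (hpos : ∀ x, 0 < f x)
    (hfi : Integrable f) :
    StrictMono (fun t => ∫ s in Iic t, f s) ∧
      (∀ t, HasDerivAt (fun t => ∫ s in Iic t, f s) (f t) t) ∧
      range (fun t => ∫ s in Iic t, f s) = Ioo 0 (∫ s, f s) := by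
  have hd (t : ℝ) : HasDerivAt (fun t => ∫ s in Iic t, f s) (f t) t := by
    have h1 : (fun t => ∫ s in Iic t, f s) = fun t => (∫ s in Iic 0, f s) + ∫ s in (0 : ℝ)..t, f s := by
      funext t
      rw [← intervalIntegral.integral_Iic_sub_Iic hfi.integrableOn hfi.integrableOn]
      ring
    rw [h1]
    exact (intervalIntegral.integral_hasDerivAt_right (hf.intervalIntegrable _ _)
      hf.stronglyMeasurable.stronglyMeasurableAtFilter hf.continuousAt).const_add _
  have hm : StrictMono (fun t => ∫ s in Iic t, f s) :=
    strictMono_of_hasDerivAt_pos hd hpos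
  refine ⟨hm, hd, ?_⟩
  have hbot : Tendsto (fun t => ∫ s in Iic t, f s) atBot (𝓝 0) :=
    tendsto_integral_Iic_zero tendsto_id
  have htop : Tendsto (fun t => ∫ s in Iic t, f s) atTop (𝓝 (∫ s, f s)) := by
    have := (intervalIntegral_tendsto_integral_Ioi 0 hfi.integrableOn tendsto_id).const_add
      (∫ s in Iic 0, f s)
    rw [intervalIntegral.integral_Iic_add_Ioi hfi.integrableOn hfi.integrableOn] at this
    refine this.congr fun t => ?_
    rw [id, ← intervalIntegral.integral_Iic_sub_Iic hfi.integrableOn hfi.integrableOn]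
    ring
  apply Subset.antisymm
  · rintro _ ⟨t, rfl⟩
    constructor
    · exact (setIntegral_nonneg measurableSet_Iic fun s _ => (hpos s).le).trans_lt
        (hm (sub_one_lt t))
    · exact (hm (lt_add_one t)).trans_le
        (setIntegral_le_integral hfi (Eventually.of_forall fun s => (hpos s).le))
  · rintro c ⟨h0, h1⟩
    have hc : Continuous (fun t => ∫ s in Iic t, f s) :=
      continuous_iff_continuousAt.2 fun t => (hd t).continuousAt
    obtain ⟨a, ha⟩ := (hbot.eventually (gt_mem_nhds h0)).exists
    obtain ⟨b, hb⟩ := (htop.eventually (lt_mem_nhds h1)).exists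
    exact mem_range_of_exists_le_of_exists_ge hc ⟨a, ha.le⟩ ⟨b, hb.le⟩

/-- Monotone transport between two continuous positive densities on the line. -/
theorem exists_monotone_transport {f g : ℝ → ℝ} (hf : Continuous f) (hg : Continuous g)
    (hf0 : ∀ x, 0 < f x) (hg0 : ∀ x, 0 < g x) (hfi : Integrable f) (hgi : Integrable g)
    (hfg : ∫ x, f x = ∫ x, g x) :
    ∃ T : ℝ → ℝ, StrictMono T ∧ ∀ t, HasDerivAt T (f t / g (T t)) t := by
  obtain ⟨hF, hF', hFr⟩ := range_integral_Iic hf hf0 hfi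
  obtain ⟨hG, hG', hGr⟩ := range_integral_Iic hg hg0 hgi
  set F := fun t => ∫ s in Iic t, f s
  set G := fun t => ∫ s in Iic t, g s
  have hr : range F = range G := by rw [hFr, hGr, hfg]
  have h1 (t : ℝ) : ∃ s, G s = F t := by
    rw [← mem_range, ← hr]; exact mem_range_self t
  -- `T` is `G⁻¹ ∘ F`; it exists because both distribution functions have the range `(0, Z)` for the
  -- common mass `Z`.
  choose T hT using h1
  have hTm : StrictMono T := fun a b hab => by
    rw [← hG.lt_iff_lt, hT, hT]; exact hF hab
  have hTs : Function.Surjective T := fun s => by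
    have : G s ∈ range F := hr ▸ mem_range_self s
    obtain ⟨t, ht⟩ := this
    exact ⟨t, hG.injective (by rw [hT, ht])⟩
  have hTc : Continuous T := hTm.monotone.continuous_of_surjective hTs
  refine ⟨T, hTm, fun t => ?_⟩
  have hFd := hF' t
  -- Since `G ∘ T = F`, the slope of `T` is the slope of `F` divided by that of `G` along `T`;
  -- continuity and injectivity of `T` let the latter converge.
  have key : Filter.Tendsto (slope T t) (nhdsWithin t {t}ᶜ) (nhds (f t / g (T t))) := by
    have h2 : Filter.Tendsto (slope F t) (nhdsWithin t {t}ᶜ) (nhds (f t)) :=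
      hasDerivAt_iff_tendsto_slope.1 hFd
    have h3 : Filter.Tendsto (slope G (T t)) (nhdsWithin (T t) {T t}ᶜ) (nhds (g (T t))) :=
      hasDerivAt_iff_tendsto_slope.1 (hG' (T t))
    have h4 : Filter.Tendsto T (nhdsWithin t {t}ᶜ) (nhdsWithin (T t) {T t}ᶜ) :=
      hTc.continuousWithinAt.tendsto_nhdsWithin fun s hs => by
        simpa [hTm.injective.eq_iff] using hs
    refine (h2.div (h3.comp h4) (hg0 _).ne').congr' ?_
    filter_upwards [self_mem_nhdsWithin] with s hs
    have hs' : s ≠ t := by simpa using hs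
    have : T s ≠ T t := hTm.injective.ne hs'
    have h5 : G (T s) - G (T t) ≠ 0 := sub_ne_zero.2 (hG.injective.ne this)
    have h6 := sub_ne_zero.2 this
    have h7 := sub_ne_zero.2 hs'
    simp only [Pi.div_apply, Function.comp, slope_def_field]
    rw [← hT s, ← hT t]
    field_simp
  exact hasDerivAt_iff_tendsto_slope.2 key

/-! ### Isotropic measures and the Brascamp-Lieb inequality -/

section Isotropic

open scoped RealInnerProductSpace

variable {E : Type*} [NormedAddCommGroup E] [InnerProductSpace ℝ E] [FiniteDimensional ℝ E]
  [MeasurableSpace E] [BorelSpace E] {Ω : Type*} [MeasurableSpace Ω]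

/-- A finite measure `ν` and a map `u` to the unit sphere which decompose the identity:
`∫ u ⊗ u dν = id`. -/
structure IsIsotropic (ν : Measure Ω) (u : Ω → E) : Prop where
  measurable : Measurable u
  finite : IsFiniteMeasure ν
  norm_eq_one : ∀ᵐ ω ∂ν, ‖u ω‖ = 1
  integral_inner_sq : ∀ x, ∫ ω, ⟪u ω, x⟫ ^ 2 ∂ν = ‖x‖ ^ 2

namespace IsIsotropic

variable {ν : Measure Ω} {u : Ω → E}

/-- Continuous functions of `u` are integrable. -/
theorem integrable_comp {G : Type*} [NormedAddCommGroup G] (h : IsIsotropic ν u) {φ : E → G}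
    (hφ : Continuous φ) : Integrable (fun ω => φ (u ω)) ν := by
  have := h.finite
  obtain ⟨C, hC⟩ := (isCompact_sphere (0 : E) 1).exists_bound_of_continuousOn hφ.continuousOn
  refine Integrable.of_bound (C := C)
    (hφ.comp_aestronglyMeasurable h.measurable.aestronglyMeasurable) ?_
  filter_upwards [h.norm_eq_one] with ω hω
  exact hC _ (by simpa using hω)

/-- The trace of `∫ u ⊗ u dν = id`. -/
theorem measureReal_univ (h : IsIsotropic ν u) : ν.real univ = Module.finrank ℝ E := by
  have h1 : ∫ ω, ∑ i, ⟪u ω, stdOrthonormalBasis ℝ E i⟫ ^ 2 ∂ν = ∫ _, (1 : ℝ) ∂ν := by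
    refine integral_congr_ae ?_
    filter_upwards [h.norm_eq_one] with ω hω
    rw [(stdOrthonormalBasis ℝ E).sum_sq_inner_left, hω, one_pow]
  rw [integral_finsetSum _ fun i _ => h.integrable_comp
    (φ := fun v => ⟪v, stdOrthonormalBasis ℝ E i⟫ ^ 2) (by fun_prop)] at h1
  simp_rw [h.integral_inner_sq] at h1
  simpa using h1.symm

/-- Jensen's inequality for the logarithm with respect to the probability measure
`⟪u, e⟫ ^ 2 • ν`. -/
theorem exp_integral_log_mul_le (h : IsIsotropic ν u) {w : E → ℝ} (hw : Continuous w)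
    (hw0 : ∀ v, 0 < w v) {e : E} (he : ‖e‖ = 1) :
    Real.exp (∫ ω, Real.log (w (u ω)) * ⟪u ω, e⟫ ^ 2 ∂ν) ≤ ∫ ω, w (u ω) * ⟪u ω, e⟫ ^ 2 ∂ν := by
  have hlog : Continuous fun v => Real.log (w v) := hw.log fun v => (hw0 v).ne'
  set L := ∫ ω, Real.log (w (u ω)) * ⟪u ω, e⟫ ^ 2 ∂ν with hL
  have hi : Integrable (fun ω => ⟪u ω, e⟫ ^ 2) ν :=
    h.integrable_comp (φ := fun v => ⟪v, e⟫ ^ 2) (by fun_prop)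
  have hi2 : Integrable (fun ω => Real.log (w (u ω)) * ⟪u ω, e⟫ ^ 2) ν :=
    h.integrable_comp (φ := fun v => Real.log (w v) * ⟪v, e⟫ ^ 2) (by fun_prop)
  -- Jensen by the tangent of `exp` at `L`: the integrand on the right is the tangent value `e ^ L
  -- (1 + log w - L)`, which lies below `w`.
  have h1 : Real.exp L = ∫ ω, Real.exp L * ((1 - L) * ⟪u ω, e⟫ ^ 2 +
      Real.log (w (u ω)) * ⟪u ω, e⟫ ^ 2) ∂ν := by
    rw [integral_const_mul, integral_add (hi.const_mul _) hi2, integral_const_mul,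
      h.integral_inner_sq, he, ← hL]
    ring
  rw [h1]
  refine integral_mono (((hi.const_mul _).add hi2).const_mul _)
    (h.integrable_comp (φ := fun v => w v * ⟪v, e⟫ ^ 2) (by fun_prop)) fun ω => ?_
  have h2 := Real.add_one_le_exp (Real.log (w (u ω)) - L)
  rw [Real.exp_sub, Real.exp_log (hw0 _), le_div_iff₀ (Real.exp_pos _)] at h2
  have := mul_le_mul_of_nonneg_right h2 (sq_nonneg ⟪u ω, e⟫)
  simp only
  linarith

/-- Ball's determinant inequality `det (∫ w u ⊗ u dν) ≥ exp (∫ log w dν)`. -/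
theorem exp_integral_log_le_abs_det (h : IsIsotropic ν u) {w : E → ℝ} (hw : Continuous w)
    (hw0 : ∀ v, 0 < w v) (M : E →L[ℝ] E)
    (hM : ∀ x y, ⟪M x, y⟫ = ∫ ω, w (u ω) * (⟪u ω, x⟫ * ⟪u ω, y⟫) ∂ν) :
    Real.exp (∫ ω, Real.log (w (u ω)) ∂ν) ≤ |M.det| := by
  have hs : (M : E →ₗ[ℝ] E).IsSymmetric := fun x y => by
    change ⟪M x, y⟫ = ⟪x, M y⟫
    rw [real_inner_comm (M y) x, hM, hM]
    simp_rw [mul_comm ⟪u _, x⟫]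
  have hlog : Continuous fun v => Real.log (w v) := hw.log fun v => (hw0 v).ne'
  -- In an eigenbasis of `M` the determinant is the product of `∫ w ⟪u, b i⟫ ^ 2`. Jensen applies to
  -- each factor, and the exponents add up because `∑ ⟪u, b i⟫ ^ 2 = 1`.
  let b := hs.eigenvectorBasis rfl
  have hev (i) : hs.eigenvalues rfl i = ∫ ω, w (u ω) * ⟪u ω, b i⟫ ^ 2 ∂ν := by
    have h1 := hM (b i) (b i)
    have h2 : M (b i) = hs.eigenvalues rfl i • b i := hs.apply_eigenvectorBasis rfl i
    rw [h2, inner_smul_left, real_inner_self_eq_norm_sq, b.norm_eq_one] at h1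
    simpa [← sq] using h1
  have hdet : M.det = ∏ i, hs.eigenvalues rfl i := by
    simpa using hs.det_eq_prod_eigenvalues rfl
  have hsum : ∫ ω, Real.log (w (u ω)) ∂ν =
      ∑ i, ∫ ω, Real.log (w (u ω)) * ⟪u ω, b i⟫ ^ 2 ∂ν := by
    rw [← integral_finsetSum _ fun i _ => h.integrable_comp
      (φ := fun v => Real.log (w v) * ⟪v, b i⟫ ^ 2) (by fun_prop)]
    refine integral_congr_ae ?_
    filter_upwards [h.norm_eq_one] with ω hω
    rw [← Finset.mul_sum, b.sum_sq_inner_left, hω, one_pow, mul_one]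
  rw [hsum, Real.exp_sum, hdet]
  refine (Finset.prod_le_prod (fun i _ => (Real.exp_pos _).le) fun i _ => ?_).trans (le_abs_self _)
  rw [hev]
  exact h.exp_integral_log_mul_le hw hw0 (b.norm_eq_one i)

theorem inner_integral_smul (h : IsIsotropic ν u) {t : E → ℝ} (ht : Continuous t) (y : E) :
    ⟪∫ ω, t (u ω) • u ω ∂ν, y⟫ = ∫ ω, t (u ω) * ⟪u ω, y⟫ ∂ν := by
  rw [real_inner_comm, ← integral_inner (h.integrable_comp (φ := fun v => t v • v) (by fun_prop))]
  simp_rw [inner_smul_right, real_inner_comm y]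

/-- A Bessel inequality: `x ↦ ⟪u, x⟫` is an isometry into `L_2(ν)`, and `y` is the image of `t`
under its adjoint, a contraction. -/
theorem norm_integral_smul_sq_le (h : IsIsotropic ν u) {t : E → ℝ} (ht : Continuous t) :
    ‖∫ ω, t (u ω) • u ω ∂ν‖ ^ 2 ≤ ∫ ω, t (u ω) ^ 2 ∂ν := by
  set y := ∫ ω, t (u ω) • u ω ∂ν
  have h1 : 0 ≤ ∫ ω, (t (u ω) - ⟪u ω, y⟫) ^ 2 ∂ν := integral_nonneg fun ω => sq_nonneg _
  have h2 (ω) : (t (u ω) - ⟪u ω, y⟫) ^ 2 =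
    t (u ω) ^ 2 - 2 * (t (u ω) * ⟪u ω, y⟫) + ⟪u ω, y⟫ ^ 2 := by ring
  simp_rw [h2] at h1
  have i1 : Integrable (fun ω => t (u ω) ^ 2) ν :=
    h.integrable_comp (φ := fun v => t v ^ 2) (by fun_prop)
  have i2 : Integrable (fun ω => 2 * (t (u ω) * ⟪u ω, y⟫)) ν :=
    h.integrable_comp (φ := fun v => 2 * (t v * ⟪v, y⟫)) (by fun_prop)
  have i3 : Integrable (fun ω => ⟪u ω, y⟫ ^ 2) ν :=
    h.integrable_comp (φ := fun v => ⟪v, y⟫ ^ 2) (by fun_prop)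
  have i12 : Integrable (fun ω => t (u ω) ^ 2 - 2 * (t (u ω) * ⟪u ω, y⟫)) ν := i1.sub i2
  rw [integral_add i12 i3, integral_sub i1 i2, integral_const_mul,
    ← h.inner_integral_smul ht, h.integral_inner_sq, real_inner_self_eq_norm_sq] at h1
  linarith

theorem hasFDerivAt_integral_smul (h : IsIsotropic ν u) {T T' : ℝ → ℝ}
    (hT : ∀ t, HasDerivAt T (T' t) t) (hT' : Continuous T') (x : E) :
    HasFDerivAt (fun x => ∫ ω, T ⟪u ω, x⟫ • u ω ∂ν)
      (∫ ω, T' ⟪u ω, x⟫ • (innerSL ℝ (u ω)).smulRight (u ω) ∂ν) x := by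
  have := h.finite
  have hTc : Continuous T := continuous_iff_continuousAt.2 fun t => (hT t).continuousAt
  -- For `y` in the unit ball around `x`, `⟪u, y⟫` stays in this interval, where `T'` is bounded; a
  -- constant dominates since `ν` is finite.
  obtain ⟨C, hC⟩ := (isCompact_Icc (a := -(‖x‖ + 1)) (b := ‖x‖ + 1)).exists_bound_of_continuousOn
    hT'.continuousOn
  refine hasFDerivAt_integral_of_dominated_of_fderiv_le
    (F' := fun x ω => T' ⟪u ω, x⟫ • (innerSL ℝ (u ω)).smulRight (u ω)) (bound := fun _ => C)
    (Metric.ball_mem_nhds x one_pos) ?_ ?_ ?_ ?_ (integrable_const _) ?_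
  · exact Filter.Eventually.of_forall fun y => (h.integrable_comp
      (φ := fun v => T ⟪v, y⟫ • v) (by fun_prop)).aestronglyMeasurable
  · exact h.integrable_comp (φ := fun v => T ⟪v, x⟫ • v) (by fun_prop)
  · refine (h.integrable_comp
      (φ := fun v => T' ⟪v, x⟫ • (innerSL ℝ v).smulRight v) ?_).aestronglyMeasurable
    refine (hT'.comp (by fun_prop)).smul ?_
    exact (ContinuousLinearMap.smulRightL ℝ E E).continuous₂.comp
      ((innerSL ℝ).continuous.prodMk continuous_id)
  · filter_upwards [h.norm_eq_one] with ω hω y hy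
    rw [norm_smul, ContinuousLinearMap.norm_smulRight_apply, innerSL_apply_norm, hω, mul_one,
      mul_one]
    refine hC _ (abs_le.1 ((abs_real_inner_le_norm _ _).trans ?_))
    rw [hω, one_mul]
    have h1 : ‖y - x‖ < 1 := by simpa [dist_eq_norm] using hy
    have h2 := norm_add_le (y - x) x
    rw [sub_add_cancel] at h2
    linarith
  · refine Filter.Eventually.of_forall fun ω y _ => ?_
    have h1 : HasFDerivAt (fun y => ⟪u ω, y⟫) (innerSL ℝ (u ω)) y :=
      (innerSL ℝ (u ω)).hasFDerivAt
    have h2 := ((hT ⟪u ω, y⟫).comp_hasFDerivAt y h1).smul_const (u ω)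
    exact h2.congr_fderiv (ContinuousLinearMap.ext fun z => by simp [mul_smul])

/-- The map is strictly monotone: pairing the difference of two values with `x - y` gives the
integral of a nonnegative function. If that vanishes then `⟪u, x - y⟫ = 0` almost everywhere, and
isotropy gives `x = y`. -/
theorem injective_integral_smul (h : IsIsotropic ν u) {T : ℝ → ℝ} (hT : Continuous T)
    (hm : StrictMono T) : Function.Injective (fun x => ∫ ω, T ⟪u ω, x⟫ • u ω ∂ν) := by
  intro x y hxy
  have e1 : ∫ ω, (T ⟪u ω, x⟫ - T ⟪u ω, y⟫) * ⟪u ω, x - y⟫ ∂ν = 0 := by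
    rw [← h.inner_integral_smul (t := fun v => T ⟪v, x⟫ - T ⟪v, y⟫) (by fun_prop)]
    simp_rw [sub_smul]
    rw [integral_sub (h.integrable_comp (φ := fun v => T ⟪v, x⟫ • v) (by fun_prop))
      (h.integrable_comp (φ := fun v => T ⟪v, y⟫ • v) (by fun_prop))]
    simp only at hxy
    rw [hxy, sub_self, inner_zero_left]
  have hn (ω) : 0 ≤ (T ⟪u ω, x⟫ - T ⟪u ω, y⟫) * ⟪u ω, x - y⟫ := by
    rw [inner_sub_right]
    rcases le_total ⟪u ω, x⟫ ⟪u ω, y⟫ with h1 | h1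
    · exact mul_nonneg_of_nonpos_of_nonpos (sub_nonpos.2 (hm.monotone h1)) (sub_nonpos.2 h1)
    · exact mul_nonneg (sub_nonneg.2 (hm.monotone h1)) (sub_nonneg.2 h1)
  rw [integral_eq_zero_iff_of_nonneg hn (h.integrable_comp
    (φ := fun v => (T ⟪v, x⟫ - T ⟪v, y⟫) * ⟪v, x - y⟫) (by fun_prop))] at e1
  have e2 : ∫ ω, ⟪u ω, x - y⟫ ^ 2 ∂ν = ∫ _, (0 : ℝ) ∂ν := by
    refine integral_congr_ae ?_
    filter_upwards [e1] with ω hω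
    rcases mul_eq_zero.1 hω with h1 | h1
    · rw [inner_sub_right, hm.injective (sub_eq_zero.1 h1), sub_self, zero_pow two_ne_zero]
    · rw [h1, zero_pow two_ne_zero]
  rw [h.integral_inner_sq, integral_zero] at e2
  exact sub_eq_zero.1 (norm_eq_zero.1 (pow_eq_zero_iff two_ne_zero |>.1 e2))

/-- The Brascamp-Lieb inequality for an isotropic measure and a single density. -/
theorem lintegral_exp_integral_log_le (h : IsIsotropic ν u) {f : ℝ → ℝ} (hf : Continuous f)
    (hf0 : ∀ t, 0 < f t) (hfi : Integrable f) :
    ∫⁻ x, ENNReal.ofReal (Real.exp (∫ ω, Real.log (f ⟪u ω, x⟫) ∂ν)) ≤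
      ENNReal.ofReal ((∫ t, f t) ^ Module.finrank ℝ E) := by
  set Z := ∫ t, f t with hZ
  have hZ0 : 0 < Z := by
    rw [hZ, integral_pos_iff_support_of_nonneg (fun t => (hf0 t).le) hfi]
    have : Function.support f = univ := by ext t; simp [(hf0 t).ne']
    rw [this]; simp
  -- Chosen so that the Gaussian `exp (-b t ^ 2)` has the same mass `Z` as `f`.
  set b := Real.pi / Z ^ 2 with hb
  have hb0 : 0 < b := by positivity
  have hgauss : ∫ t, Real.exp (-b * t ^ 2) = Z := by
    rw [integral_gaussian, hb, div_div_cancel₀ Real.pi_ne_zero, Real.sqrt_sq hZ0.le]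
  obtain ⟨T, hTm, hT⟩ := exists_monotone_transport hf (g := fun t => Real.exp (-b * t ^ 2))
    (by fun_prop) hf0 (fun t => Real.exp_pos _) hfi (integrable_exp_neg_mul_sq hb0)
    (by rw [hgauss])
  have hTc : Continuous T := continuous_iff_continuousAt.2 fun t => (hT t).continuousAt
  set T' := fun t => f t / Real.exp (-b * T t ^ 2) with hT'
  have hT'c : Continuous T' := hf.div (by fun_prop) fun t => (Real.exp_pos _).ne'
  have hT'0 (t) : 0 < T' t := div_pos (hf0 t) (Real.exp_pos _)
  set Θ : E → E := fun x => ∫ ω, T ⟪u ω, x⟫ • u ω ∂ν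
  set D : E → E →L[ℝ] E := fun x => ∫ ω, T' ⟪u ω, x⟫ • (innerSL ℝ (u ω)).smulRight (u ω) ∂ν
  have hΘ (x) : HasFDerivAt Θ (D x) x := h.hasFDerivAt_integral_smul hT hT'c x
  have hDc (x : E) : Continuous fun v : E => T' ⟪v, x⟫ • (innerSL ℝ v).smulRight v := by
    refine (hT'c.comp (by fun_prop)).smul ?_
    exact (ContinuousLinearMap.smulRightL ℝ E E).continuous₂.comp
      ((innerSL ℝ).continuous.prodMk continuous_id)
  have hdet (x) : Real.exp (∫ ω, Real.log (T' ⟪u ω, x⟫) ∂ν) ≤ |(D x).det| := by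
    refine h.exp_integral_log_le_abs_det (w := fun v => T' ⟪v, x⟫) (by fun_prop)
      (fun v => hT'0 _) (D x) fun y z => ?_
    have h1 : D x y = ∫ ω, (T' ⟪u ω, x⟫ * ⟪u ω, y⟫) • u ω ∂ν := by
      rw [ContinuousLinearMap.integral_apply (h.integrable_comp (hDc x))]
      simp [mul_smul]
    rw [h1, h.inner_integral_smul (t := fun v => T' ⟪v, x⟫ * ⟪v, y⟫) (by fun_prop)]
    simp_rw [mul_assoc]
  -- Taking logarithms in `f = T' · exp (-b T ^ 2)` splits the integrand: the `T'` part is bounded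
  -- by the Jacobian of `Θ`, the Gaussian part by `‖Θ x‖ ^ 2 ≤ ∫ T ^ 2 dν`.
  have hpt (x) : ENNReal.ofReal (Real.exp (∫ ω, Real.log (f ⟪u ω, x⟫) ∂ν)) ≤
      ENNReal.ofReal |(D x).det| * ENNReal.ofReal (Real.exp (-b * ‖Θ x‖ ^ 2)) := by
    rw [← ENNReal.ofReal_mul (abs_nonneg _)]
    refine ENNReal.ofReal_le_ofReal ?_
    have hl (t) : Real.log (f t) = Real.log (T' t) + -b * T t ^ 2 := by
      simp only [hT']
      rw [Real.log_div (hf0 t).ne' (Real.exp_pos _).ne', Real.log_exp]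
      ring
    simp_rw [hl]
    rw [integral_add (h.integrable_comp (φ := fun v => Real.log (T' ⟪v, x⟫))
        (Continuous.log (by fun_prop) fun v => (hT'0 _).ne'))
      (h.integrable_comp (φ := fun v => -b * T ⟪v, x⟫ ^ 2) (by fun_prop)), Real.exp_add,
      integral_const_mul]
    refine mul_le_mul (hdet x) (Real.exp_le_exp.2 ?_) (Real.exp_pos _).le (abs_nonneg _)
    have := h.norm_integral_smul_sq_le (t := fun v => T ⟪v, x⟫) (by fun_prop)
    nlinarith
  calc ∫⁻ x, ENNReal.ofReal (Real.exp (∫ ω, Real.log (f ⟪u ω, x⟫) ∂ν))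
      ≤ ∫⁻ x in univ, ENNReal.ofReal |(D x).det| *
          ENNReal.ofReal (Real.exp (-b * ‖Θ x‖ ^ 2)) := by
        rw [setLIntegral_univ]; exact lintegral_mono hpt
    _ = ∫⁻ y in Θ '' univ, ENNReal.ofReal (Real.exp (-b * ‖y‖ ^ 2)) :=
        (lintegral_image_eq_lintegral_abs_det_fderiv_mul volume MeasurableSet.univ
          (fun x _ => (hΘ x).hasFDerivWithinAt)
          (h.injective_integral_smul hTc hTm).injOn
          (fun y => ENNReal.ofReal (Real.exp (-b * ‖y‖ ^ 2)))).symm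
    _ ≤ ∫⁻ y : E, ENNReal.ofReal (Real.exp (-b * ‖y‖ ^ 2)) := setLIntegral_le_lintegral _ _
    _ = ENNReal.ofReal (Z ^ Module.finrank ℝ E) := by
        have hv := GaussianFourier.integral_rexp_neg_mul_sq_norm (V := E) hb0
        rw [← ofReal_integral_eq_lintegral_ofReal _
          (Filter.Eventually.of_forall fun _ => (Real.exp_pos _).le), hv, hb,
          div_div_cancel₀ Real.pi_ne_zero, ← Real.rpow_natCast Z 2, ← Real.rpow_mul hZ0.le]
        · congr 1
          rw [← Real.rpow_natCast]
          congr 1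
          push_cast
          ring
        · refine Integrable.of_integral_ne_zero ?_
          rw [hv]
          positivity

end IsIsotropic

end Isotropic

/-! ### Lewis' position of a subspace of `L_p` -/

section LewisPosition

open scoped RealInnerProductSpace

variable {E : Type*} [NormedAddCommGroup E] [InnerProductSpace ℝ E] [FiniteDimensional ℝ E]
  {Ω : Type*} [MeasurableSpace Ω] {μ : Measure Ω}

/-- Minimality is tested on the stretching `R` of the direction `x` by `√(1 + τ)`, rescaled to
determinant one. This stretching makes `‖R y‖ ^ 2` affine in `τ`, and equality holds at `τ = 0`, so
the two sides can be differentiated there. -/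
theorem rpow_mul_integral_le_of_minimal {p : ℝ} [Nontrivial E] {h : Ω → E}
    (hmin : ∀ B : E →L[ℝ] E, B.det = 1 → ∫ ω, ‖h ω‖ ^ p ∂μ ≤ ∫ ω, ‖B (h ω)‖ ^ p ∂μ)
    {x : E} (hx : ‖x‖ = 1) {τ : ℝ} (hτ : -1 < τ) :
    (1 + τ) ^ (p / (2 * Module.finrank ℝ E)) * ∫ ω, ‖h ω‖ ^ p ∂μ ≤
      ∫ ω, (‖h ω‖ ^ 2 + τ * ⟪h ω, x⟫ ^ 2) ^ (p / 2) ∂μ := by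
  set d := Module.finrank ℝ E with hd
  have hd0 : 0 < d := Module.finrank_pos
  have hdR : (0 : ℝ) < d := by exact_mod_cast hd0
  set s := √(1 + τ) with hs
  have hs0 : 0 < s := Real.sqrt_pos.2 (by linarith)
  have hs2 : s ^ 2 = 1 + τ := Real.sq_sqrt (by linarith)
  let R : E →L[ℝ] E := ContinuousLinearMap.id ℝ E + (innerSL ℝ x).smulRight ((s - 1) • x)
  have hR (y) : R y = y + ((s - 1) * ⟪x, y⟫) • x := by
    simp [R, smul_smul, mul_comm]
  have hRdet : R.det = s := by
    have h1 : (R : E →ₗ[ℝ] E) = LinearMap.transvection (innerSL ℝ x : E →ₗ[ℝ] ℝ) ((s - 1) • x) := by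
      ext y
      simp [R, LinearMap.transvection.apply]
    rw [ContinuousLinearMap.det, h1, LinearMap.transvection.det]
    simp [hx]
  have hRn (y) : ‖R y‖ ^ p = (‖y‖ ^ 2 + τ * ⟪y, x⟫ ^ 2) ^ (p / 2) := by
    have h1 : ‖R y‖ ^ 2 = ‖y‖ ^ 2 + τ * ⟪y, x⟫ ^ 2 := by
      rw [hR, norm_add_sq_real, norm_smul, hx, inner_smul_right, real_inner_comm y x, mul_one,
        Real.norm_eq_abs, sq_abs]
      have : τ = s ^ 2 - 1 := by linarith
      rw [this]
      ring
    rw [← h1, ← Real.rpow_natCast, ← Real.rpow_mul (norm_nonneg _)]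
    congr 1
    push_cast
    ring
  set c := s ^ (-(1 / d : ℝ)) with hc
  have hc0 : 0 < c := Real.rpow_pos_of_pos hs0 _
  have hdet : (c • R).det = 1 := by
    rw [ContinuousLinearMap.det, ContinuousLinearMap.toLinearMap_smul, LinearMap.det_smul]
    change c ^ d * R.det = 1
    rw [hRdet, hc, ← Real.rpow_natCast, ← Real.rpow_mul hs0.le]
    rw [neg_mul, one_div_mul_cancel hdR.ne', Real.rpow_neg_one, inv_mul_cancel₀ hs0.ne']
  have h1 := hmin _ hdet
  simp_rw [smul_apply, norm_smul, Real.norm_of_nonneg hc0.le,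
    Real.mul_rpow hc0.le (norm_nonneg _), hRn] at h1
  rw [integral_const_mul] at h1
  have h2 : (1 + τ) ^ (p / (2 * d)) * c ^ p = 1 := by
    rw [← hs2, hc, ← Real.rpow_natCast, ← Real.rpow_mul hs0.le, ← Real.rpow_mul hs0.le,
      ← Real.rpow_add hs0]
    rw [show ((2 : ℕ) : ℝ) * (p / (2 * d)) + -(1 / d) * p = 0 by push_cast; field_simp; ring,
      Real.rpow_zero]
  calc _ ≤ (1 + τ) ^ (p / (2 * d)) * (c ^ p * ∫ ω, (‖h ω‖ ^ 2 + τ * ⟪h ω, x⟫ ^ 2) ^ (p / 2) ∂μ) :=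
        mul_le_mul_of_nonneg_left h1 (Real.rpow_nonneg (by linarith) _)
    _ = _ := by rw [← mul_assoc, h2, one_mul]


theorem norm_toLp_rpow {G : Type*} [NormedAddCommGroup G] {p : ℝ} (hp : 0 < p) {f : Ω → G}
    (hf : MemLp f (ENNReal.ofReal p) μ) : ‖hf.toLp f‖ ^ p = ∫ ω, ‖f ω‖ ^ p ∂μ := by
  have h0 : 0 ≤ ∫ ω, ‖f ω‖ ^ p ∂μ := integral_nonneg fun _ => by positivity
  rw [Lp.norm_toLp, hf.eLpNorm_eq_integral_rpow_norm (by simpa using hp) ENNReal.ofReal_ne_top,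
    ENNReal.toReal_ofReal hp.le, ENNReal.toReal_ofReal (by positivity), Real.rpow_inv_rpow h0 hp.ne']

theorem integrable_norm_rpow_of_memLp {G : Type*} [NormedAddCommGroup G] {p : ℝ} (hp : 0 < p)
    {f : Ω → G} (hf : MemLp f (ENNReal.ofReal p) μ) : Integrable (fun ω => ‖f ω‖ ^ p) μ := by
  have := hf.integrable_norm_rpow (by simpa using hp) ENNReal.ofReal_ne_top
  rwa [ENNReal.toReal_ofReal hp.le] at this

open Filter in
/-- Existence of a volume preserving linear image of `f` of least `L_p` norm. -/
theorem exists_minimal_integral_norm_rpow {p : ℝ} (hp : 1 ≤ p) {f : Ω → E}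
    (hf : MemLp f (ENNReal.ofReal p) μ)
    (hnd : ∀ x, (∀ᵐ ω ∂μ, ⟪f ω, x⟫ = 0) → x = 0) :
    ∃ A : E →L[ℝ] E, A.det = 1 ∧
      ∀ B : E →L[ℝ] E, B.det = 1 → ∫ ω, ‖A (f ω)‖ ^ p ∂μ ≤ ∫ ω, ‖B (f ω)‖ ^ p ∂μ := by
  have hp0 : 0 < p := by linarith
  have : Fact (1 ≤ ENNReal.ofReal p) := ⟨by simpa using hp⟩
  let L : (E →L[ℝ] E) →ₗ[ℝ] Lp E (ENNReal.ofReal p) μ :=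
    { toFun := fun A => A.compLp (hf.toLp f)
      map_add' := fun A B => ContinuousLinearMap.add_compLp A B _
      map_smul' := fun c A => ContinuousLinearMap.smul_compLp c A _ }
  have hLf (A : E →L[ℝ] E) : L A =ᵐ[μ] fun ω => A (f ω) := by
    filter_upwards [A.coeFn_compLp (hf.toLp f), hf.coeFn_toLp] with ω h1 h2
    rw [← h2]; exact h1
  have hL (A : E →L[ℝ] E) : ‖L A‖ ^ p = ∫ ω, ‖A (f ω)‖ ^ p ∂μ := by
    have h1 : MemLp (fun ω => A (f ω)) (ENNReal.ofReal p) μ := A.comp_memLp' hf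
    rw [← norm_toLp_rpow hp0 h1]
    congr 2
  -- If `A ∘ f = 0` almost everywhere then `f` is orthogonal to the range of the adjoint of `A`,
  -- which is therefore zero.
  have hker : LinearMap.ker L = ⊥ := by
    refine LinearMap.ker_eq_bot'.2 fun A hA => ?_
    have h1 : ∀ᵐ ω ∂μ, A (f ω) = 0 := by
      filter_upwards [hLf A, Lp.coeFn_zero E (ENNReal.ofReal p) μ] with ω h1 h2
      rw [← h1, hA, h2, Pi.zero_apply]
    have h2 (y) : A.adjoint y = 0 := by
      refine hnd _ ?_
      filter_upwards [h1] with ω hω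
      rw [ContinuousLinearMap.adjoint_inner_right, hω, inner_zero_left]
    ext x
    refine ext_inner_right ℝ fun y => ?_
    rw [← ContinuousLinearMap.adjoint_inner_right, h2]
    simp
  -- An injective linear map from a finite-dimensional space is bounded below, hence `‖L A‖` is
  -- coercive and attains its minimum on the closed set `det = 1`.
  obtain ⟨K, hK0, hK⟩ := L.exists_antilipschitzWith hker
  have ht : Tendsto (fun A => ‖L A‖) (cocompact _) atTop := by
    have hK0' : (0 : ℝ) < K := hK0
    refine tendsto_atTop_mono (fun A => ?_) (tendsto_norm_cocompact_atTop.const_mul_atTop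
      (inv_pos.2 hK0'))
    rw [inv_mul_le_iff₀ hK0']
    simpa using hK.le_mul_dist A 0
  have hc : Continuous fun A => ‖L A‖ := L.continuous_of_finiteDimensional.norm
  obtain ⟨A, hA, hmin⟩ := hc.continuousOn.exists_isMinOn' (s := {A : E →L[ℝ] E | A.det = 1})
    (isClosed_eq ContinuousLinearMap.continuous_det continuous_const)
    (x₀ := ContinuousLinearMap.id ℝ E) (by simp [ContinuousLinearMap.det])
    ((ht.eventually_ge_atTop _).filter_mono inf_le_left)
  refine ⟨A, hA, fun B hB => ?_⟩
  rw [← hL, ← hL]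
  exact Real.rpow_le_rpow (norm_nonneg _) (hmin hB) hp0.le

variable [MeasurableSpace E] [BorelSpace E]

theorem hasDerivAt_integral_rpow {p : ℝ} (hp : 1 ≤ p) {h : Ω → E}
    (hm : MemLp h (ENNReal.ofReal p) μ) {x : E} (hx : ‖x‖ = 1) :
    HasDerivAt (fun τ : ℝ => ∫ ω, (‖h ω‖ ^ 2 + τ * ⟪h ω, x⟫ ^ 2) ^ (p / 2) ∂μ)
      (p / 2 * ∫ ω, ‖h ω‖ ^ p * (‖h ω‖⁻¹ * ⟪h ω, x⟫) ^ 2 ∂μ) 0 := by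
  have hp0 : 0 < p := by linarith
  have hi := integrable_norm_rpow_of_memLp hp0 hm
  have hmeas : AEStronglyMeasurable h μ := hm.1
  have hin : AEMeasurable (fun ω => ⟪h ω, x⟫) μ := (hmeas.inner aestronglyMeasurable_const).aemeasurable
  have hnm : AEMeasurable (fun ω => ‖h ω‖) μ := hmeas.norm.aemeasurable
  have hrp (y : E) : (‖y‖ ^ 2) ^ (p / 2) = ‖y‖ ^ p := by
    rw [← Real.rpow_natCast, ← Real.rpow_mul (norm_nonneg _)]
    congr 1
    push_cast
    ring
  have hsx (y : E) : ⟪y, x⟫ ^ 2 ≤ ‖y‖ ^ 2 := by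
    rw [← sq_abs]
    have := abs_real_inner_le_norm y x
    rw [hx, mul_one] at this
    exact pow_le_pow_left₀ (abs_nonneg _) this 2
  have key := hasDerivAt_integral_of_dominated_loc_of_deriv_le (μ := μ) (x₀ := (0 : ℝ))
    (F := fun τ ω => (‖h ω‖ ^ 2 + τ * ⟪h ω, x⟫ ^ 2) ^ (p / 2))
    (F' := fun τ ω => p / 2 * ((‖h ω‖ ^ 2 + τ * ⟪h ω, x⟫ ^ 2) ^ (p / 2 - 1) * ⟪h ω, x⟫ ^ 2))
    (bound := fun ω => p / 2 * (2 ^ (p / 2) * 2) * ‖h ω‖ ^ p)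
    (Metric.ball_mem_nhds 0 (half_pos one_pos)) ?_ ?_ ?_ ?_ (hi.const_mul _) ?_
  · refine key.2.congr_deriv ?_
    rw [← integral_const_mul]
    refine integral_congr_ae (Filter.Eventually.of_forall fun ω => ?_)
    simp only [zero_mul, add_zero]
    congr 1
    rcases eq_or_ne (h ω) 0 with h0 | h0
    · simp [h0]
    · have h1 : 0 < ‖h ω‖ := norm_pos_iff.2 h0
      rw [Real.rpow_sub_one (by positivity), hrp]
      field_simp
  · refine Filter.Eventually.of_forall fun τ => AEMeasurable.aestronglyMeasurable ?_
    fun_prop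
  · simpa [hrp] using hi
  · refine AEMeasurable.aestronglyMeasurable ?_
    fun_prop
  · refine Filter.Eventually.of_forall fun ω τ hτ => ?_
    have hτ' : |τ| < 1 / 2 := by simpa using hτ
    rw [abs_lt] at hτ'
    rcases eq_or_ne (h ω) 0 with h0 | h0
    · simp [h0, Real.zero_rpow hp0.ne']
    have h1 : 0 < ‖h ω‖ := norm_pos_iff.2 h0
    have h2 := hsx (h ω)
    -- For `|τ| < 1/2` the base stays between half and twice `‖h‖ ^ 2`. The lower bound controls the
    -- exponent `p / 2 - 1`, which may be negative.
    have h3 : ‖h ω‖ ^ 2 / 2 ≤ ‖h ω‖ ^ 2 + τ * ⟪h ω, x⟫ ^ 2 := by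
      nlinarith [sq_nonneg ⟪h ω, x⟫]
    have h4 : ‖h ω‖ ^ 2 + τ * ⟪h ω, x⟫ ^ 2 ≤ 2 * ‖h ω‖ ^ 2 := by
      nlinarith [sq_nonneg ⟪h ω, x⟫]
    set y := ‖h ω‖ ^ 2 + τ * ⟪h ω, x⟫ ^ 2
    have h5 : 0 < y := lt_of_lt_of_le (by positivity) h3
    rw [Real.norm_of_nonneg (by positivity), mul_assoc]
    refine mul_le_mul_of_nonneg_left ?_ (by positivity)
    rw [Real.rpow_sub_one h5.ne', div_mul_eq_mul_div, mul_div_assoc, mul_assoc, mul_comm 2, ← mul_assoc,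
      ← hrp, ← Real.mul_rpow (by norm_num) (by positivity)]
    refine mul_le_mul (Real.rpow_le_rpow h5.le h4 (by positivity)) ?_ (by positivity) (by positivity)
    rw [div_le_iff₀ h5]
    linarith
  · refine Filter.Eventually.of_forall fun ω τ hτ => ?_
    have hτ' : |τ| < 1 / 2 := by simpa using hτ
    rw [abs_lt] at hτ'
    rcases eq_or_ne (h ω) 0 with h0 | h0
    · simpa [h0] using hasDerivAt_const τ _
    have h1 : 0 < ‖h ω‖ := norm_pos_iff.2 h0
    have h2 := hsx (h ω)
    have h3 : ‖h ω‖ ^ 2 / 2 ≤ ‖h ω‖ ^ 2 + τ * ⟪h ω, x⟫ ^ 2 := by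
      nlinarith [sq_nonneg ⟪h ω, x⟫]
    have h5 : 0 < ‖h ω‖ ^ 2 + τ * ⟪h ω, x⟫ ^ 2 := lt_of_lt_of_le (by positivity) h3
    have h6 : HasDerivAt (fun τ => ‖h ω‖ ^ 2 + τ * ⟪h ω, x⟫ ^ 2) (⟪h ω, x⟫ ^ 2) τ := by
      simpa using ((hasDerivAt_id τ).mul_const (⟪h ω, x⟫ ^ 2)).const_add (‖h ω‖ ^ 2)
    refine (h6.rpow_const (p := p / 2) (Or.inl h5.ne')).congr_deriv ?_
    ring

/-- The Euler-Lagrange equation of the minimum: the difference of the two sides of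
`rpow_mul_integral_le_of_minimal` is nonnegative near `τ = 0` and vanishes there, so its derivative
is zero. Homogeneity extends the identity from unit vectors to all `x`. -/
theorem integral_norm_rpow_mul_inner_sq_of_minimal {p : ℝ} (hp : 1 ≤ p) [Nontrivial E] {h : Ω → E}
    (hm : MemLp h (ENNReal.ofReal p) μ)
    (hmin : ∀ B : E →L[ℝ] E, B.det = 1 → ∫ ω, ‖h ω‖ ^ p ∂μ ≤ ∫ ω, ‖B (h ω)‖ ^ p ∂μ) (x : E) :
    ∫ ω, ‖h ω‖ ^ p * (‖h ω‖⁻¹ * ⟪h ω, x⟫) ^ 2 ∂μ =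
      (∫ ω, ‖h ω‖ ^ p ∂μ) / Module.finrank ℝ E * ‖x‖ ^ 2 := by
  have hp0 : 0 < p := by linarith
  have hdR : (0 : ℝ) < Module.finrank ℝ E := by exact_mod_cast Module.finrank_pos
  have unit {x : E} (hx : ‖x‖ = 1) : ∫ ω, ‖h ω‖ ^ p * (‖h ω‖⁻¹ * ⟪h ω, x⟫) ^ 2 ∂μ =
      (∫ ω, ‖h ω‖ ^ p ∂μ) / Module.finrank ℝ E := by
    have h1 := hasDerivAt_integral_rpow hp hm hx
    have h2 : HasDerivAt (fun τ : ℝ => (1 + τ) ^ (p / (2 * Module.finrank ℝ E)) *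
        ∫ ω, ‖h ω‖ ^ p ∂μ) (p / (2 * Module.finrank ℝ E) * ∫ ω, ‖h ω‖ ^ p ∂μ) 0 := by
      have h3 : HasDerivAt (fun τ : ℝ => 1 + τ) 1 0 := (hasDerivAt_id 0).const_add 1
      refine ((h3.rpow_const (p := p / (2 * Module.finrank ℝ E))
        (Or.inl (by norm_num))).mul_const _).congr_deriv ?_
      simp
    have hrp (y : E) : (‖y‖ ^ 2) ^ (p / 2) = ‖y‖ ^ p := by
      rw [← Real.rpow_natCast, ← Real.rpow_mul (norm_nonneg _)]
      congr 1
      push_cast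
      ring
    have h4 : IsLocalMin (fun τ : ℝ => (∫ ω, (‖h ω‖ ^ 2 + τ * ⟪h ω, x⟫ ^ 2) ^ (p / 2) ∂μ) -
        (1 + τ) ^ (p / (2 * Module.finrank ℝ E)) * ∫ ω, ‖h ω‖ ^ p ∂μ) 0 := by
      filter_upwards [lt_mem_nhds (show (-1 : ℝ) < 0 by norm_num)] with τ hτ
      simp only [zero_mul, add_zero, hrp, Real.one_rpow, one_mul, sub_self]
      exact sub_nonneg.2 (rpow_mul_integral_le_of_minimal hmin hx hτ)
    have h5 := h4.hasDerivAt_eq_zero (h1.sub h2)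
    generalize (∫ ω, ‖h ω‖ ^ p * (‖h ω‖⁻¹ * ⟪h ω, x⟫) ^ 2 ∂μ) = I at h5 ⊢
    generalize (∫ ω, ‖h ω‖ ^ p ∂μ) = J at h5 ⊢
    have h6 : p / 2 * I = p / 2 * (J / Module.finrank ℝ E) := by
      rw [sub_eq_zero.1 h5]
      field_simp
    exact mul_left_cancel₀ (by positivity) h6
  rcases eq_or_ne x 0 with rfl | hx
  · simp
  have hx0 : ‖x‖ ≠ 0 := norm_ne_zero_iff.2 hx
  have h1 := unit (x := ‖x‖⁻¹ • x) (by rw [norm_smul, norm_inv, norm_norm, inv_mul_cancel₀ hx0])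
  rw [← h1, mul_comm, ← integral_const_mul]
  refine integral_congr_ae (Filter.Eventually.of_forall fun ω => ?_)
  simp only [inner_smul_right]
  field_simp

/-- Lewis' theorem: a finite-dimensional subspace of `L_p`, spanned by the coordinates of `f`, has
a representation by an isotropic measure. -/
theorem exists_isIsotropic_integral_inner_rpow {p : ℝ} (hp : 1 ≤ p) [Nontrivial E] {f : Ω → E}
    (hfm : Measurable f) (hf : MemLp f (ENNReal.ofReal p) μ)
    (hnd : ∀ x, (∀ᵐ ω ∂μ, ⟪f ω, x⟫ = 0) → x = 0) :
    ∃ (A : E ≃ₗ[ℝ] E) (ν : Measure Ω) (u : Ω → E), IsIsotropic ν u ∧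
      ∀ x, ∫ ω, |⟪f ω, A x⟫| ^ p ∂μ = ∫ ω, |⟪u ω, x⟫| ^ p ∂ν := by
  have hp0 : 0 < p := by linarith
  obtain ⟨A, hA, hmin⟩ := exists_minimal_integral_norm_rpow hp hf hnd
  set h : Ω → E := fun ω => A (f ω) with hh
  have hm : MemLp h (ENNReal.ofReal p) μ := A.comp_memLp' hf
  have hi := integrable_norm_rpow_of_memLp hp0 hm
  have hmeas : Measurable h := A.continuous.measurable.comp hfm
  have hLew := integral_norm_rpow_mul_inner_sq_of_minimal hp hm fun B hB => by
    have := hmin (B.comp A) (by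
      have h1 := LinearMap.det_comp (B : E →ₗ[ℝ] E) (A : E →ₗ[ℝ] E)
      change (B.comp A).det = B.det * A.det at h1
      rw [h1, hA, hB, one_mul])
    simpa using this
  set d := Module.finrank ℝ E
  have hdR : (0 : ℝ) < d := by exact_mod_cast Module.finrank_pos
  set φ := ∫ ω, ‖h ω‖ ^ p ∂μ with hφ
  have hadj : Function.Injective (A.adjoint : E →ₗ[ℝ] E) := by
    refine (injective_iff_map_eq_zero _).2 fun x hx => ?_
    have hAd : (A : E →ₗ[ℝ] E).det ≠ 0 := by
      change A.det ≠ 0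
      rw [hA]
      exact one_ne_zero
    obtain ⟨y, hy⟩ := (LinearMap.equivOfDetNeZero _ hAd).surjective x
    have hy' : A y = x := hy
    have hx' : A.adjoint x = 0 := hx
    rw [← inner_self_eq_zero (𝕜 := ℝ)]
    nth_rewrite 1 [← hy']
    rw [← ContinuousLinearMap.adjoint_inner_right, hx', inner_zero_right]
  have hφ0 : 0 < φ := by
    refine lt_of_le_of_ne (integral_nonneg fun _ => by positivity) fun h0 => ?_
    rw [hφ, eq_comm, integral_eq_zero_iff_of_nonneg (fun _ => by positivity) hi] at h0
    obtain ⟨x, hx⟩ := exists_ne (0 : E)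
    have h1 : A.adjoint x = 0 := by
      refine hnd _ ?_
      filter_upwards [h0] with ω hω
      have : h ω = 0 := by
        rw [← norm_eq_zero]
        exact (Real.rpow_eq_zero (norm_nonneg _) hp0.ne').1 hω
      rw [ContinuousLinearMap.adjoint_inner_right]
      change ⟪h ω, x⟫ = 0
      rw [this, inner_zero_left]
    exact hx (hadj (by simpa using h1))
  have hK : 0 < d / φ := div_pos hdR hφ0
  -- With this scaling of the adjoint of `A`, the factor `c ^ p` is the constant `d / φ` that
  -- normalizes `ν` to be isotropic.
  set c := (d / φ) ^ (1 / p) with hc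
  have hc0 : 0 < c := Real.rpow_pos_of_pos hK _
  have hcp : c ^ p = d / φ := by
    rw [hc, ← Real.rpow_mul hK.le, one_div_mul_cancel hp0.ne', Real.rpow_one]
  let ρ : Ω → ℝ := fun ω => d / φ * ‖h ω‖ ^ p
  have hρm : Measurable ρ := by fun_prop
  have hρ0 (ω) : 0 ≤ ρ ω := by positivity
  have hρi : Integrable ρ μ := hi.const_mul _
  let ν := μ.withDensity fun ω => ENNReal.ofReal (ρ ω)
  have hν (g : Ω → ℝ) : ∫ ω, g ω ∂ν = ∫ ω, ρ ω * g ω ∂μ := by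
    rw [integral_withDensity_eq_integral_toReal_smul (by fun_prop) (by simp)]
    simp_rw [ENNReal.toReal_ofReal (hρ0 _), smul_eq_mul]
  have hu : Measurable fun ω => ‖h ω‖⁻¹ • h ω := by fun_prop
  refine ⟨(LinearEquiv.ofInjectiveEndo _ hadj).trans (LinearEquiv.smulOfNeZero ℝ E c hc0.ne'), ν,
    fun ω => ‖h ω‖⁻¹ • h ω, ⟨hu, ?_, ?_, fun x => ?_⟩, fun x => ?_⟩
  · exact isFiniteMeasure_withDensity_ofReal hρi.2
  · rw [ae_withDensity_iff (by fun_prop)]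
    refine Filter.Eventually.of_forall fun ω hω => ?_
    -- Where `h` vanishes the vector `‖h‖⁻¹ • h` is zero rather than unit, but the density `ρ`
    -- vanishes there too.
    have h0 : ‖h ω‖ ≠ 0 := fun h0 => hω (by simp [ρ, h0, Real.zero_rpow hp0.ne'])
    rw [norm_smul, norm_inv, norm_norm, inv_mul_cancel₀ h0]
  · rw [hν]
    simp_rw [real_inner_smul_left, ρ, mul_assoc]
    rw [integral_const_mul, hLew]
    field_simp
  · rw [hν]
    refine integral_congr_ae (Filter.Eventually.of_forall fun ω => ?_)
    have h1 : ⟪f ω, c • A.adjoint x⟫ = c * ⟪h ω, x⟫ := by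
      rw [inner_smul_right, ContinuousLinearMap.adjoint_inner_right]
    change |⟪f ω, c • A.adjoint x⟫| ^ p = ρ ω * |⟪‖h ω‖⁻¹ • h ω, x⟫| ^ p
    rw [h1, abs_mul, abs_of_pos hc0, Real.mul_rpow hc0.le (abs_nonneg _), hcp, mul_assoc,
      real_inner_smul_left, abs_mul, abs_of_nonneg (inv_nonneg.2 (norm_nonneg _)),
      Real.mul_rpow (by positivity) (abs_nonneg _), ← mul_assoc (‖h ω‖ ^ p), ← Real.mul_rpow
      (norm_nonneg _) (by positivity)]
    congr 1
    rcases eq_or_ne (h ω) 0 with h0 | h0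
    · simp [h0, Real.zero_rpow hp0.ne']
    · rw [mul_inv_cancel₀ (norm_ne_zero_iff.2 h0), Real.one_rpow, one_mul]

end LewisPosition

/-! ### Volume and inscribed ball of an isotropic `L_p` unit ball -/

section Isotropic

open scoped RealInnerProductSpace

variable {E : Type*} [NormedAddCommGroup E] [InnerProductSpace ℝ E] [FiniteDimensional ℝ E]
  [MeasurableSpace E] [BorelSpace E] {Ω : Type*} [MeasurableSpace Ω]

theorem integral_exp_neg_abs_rpow {p : ℝ} (hp : 0 < p) :
    ∫ t : ℝ, Real.exp (-|t| ^ p) = 2 * Real.Gamma (1 / p + 1) := by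
  rw [integral_comp_abs (f := fun x => Real.exp (-x ^ p)), integral_exp_neg_rpow hp]

namespace IsIsotropic

variable {ν : Measure Ω} {u : Ω → E}

theorem memLp_inner (h : IsIsotropic ν u) {p : ℝ} (hp : 1 ≤ p) (x : E) :
    MemLp (fun ω => ⟪u ω, x⟫) (ENNReal.ofReal p) ν := by
  have hp0 : 0 < p := by linarith
  refine (integrable_norm_rpow_iff (h.integrable_comp
    (φ := fun v => ⟪v, x⟫) (by fun_prop)).aestronglyMeasurable (by simpa using hp0)
    ENNReal.ofReal_ne_top).1 ?_
  exact h.integrable_comp (φ := fun v => ‖⟪v, x⟫‖ ^ (ENNReal.ofReal p).toReal)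
    (Continuous.rpow_const (by fun_prop) fun _ => Or.inr ENNReal.toReal_nonneg)

/-- The volume of a unit ball is `∫ exp (-‖x‖ ^ p) / Γ(n/p + 1)`, and the integral is bounded by
Brascamp-Lieb with `f(t) = exp (-|t| ^ p)`. Isotropy makes the seminorm a norm, as the volume
formula requires. -/
theorem volume_integral_rpow_le_one_le (h : IsIsotropic ν u) [Nontrivial E] {p : ℝ} (hp : 1 ≤ p) :
    volume {x : E | ∫ ω, |⟪u ω, x⟫| ^ p ∂ν ≤ 1} ≤
      ENNReal.ofReal ((2 * Real.Gamma (1 / p + 1)) ^ Module.finrank ℝ E /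
        Real.Gamma (Module.finrank ℝ E / p + 1)) := by
  have hp0 : 0 < p := by linarith
  have : Fact (1 ≤ ENNReal.ofReal p) := ⟨by simpa using hp⟩
  let L : E →ₗ[ℝ] Lp ℝ (ENNReal.ofReal p) ν :=
    { toFun := fun x => (h.memLp_inner hp x).toLp _
      map_add' := fun x y => by
        rw [← MemLp.toLp_add]
        congr 1
        funext ω
        exact inner_add_right _ _ _
      map_smul' := fun c x => by
        rw [RingHom.id_apply, ← MemLp.toLp_const_smul]
        congr 1
        funext ω
        exact inner_smul_right _ _ _ }
  have hL (x) : ‖L x‖ ^ p = ∫ ω, |⟪u ω, x⟫| ^ p ∂ν := norm_toLp_rpow hp0 (h.memLp_inner hp x)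
  have h0 {x} (hx : ‖L x‖ = 0) : x = 0 := by
    have h1 : (fun ω => ⟪u ω, x⟫) =ᵐ[ν] 0 :=
      (MemLp.toLp_eq_toLp_iff (h.memLp_inner hp x) MemLp.zero).1
        ((norm_eq_zero.1 hx).trans (MemLp.toLp_zero _).symm)
    have h2 := h.integral_inner_sq x
    rw [integral_congr_ae (g := fun _ => (0 : ℝ)) (by filter_upwards [h1] with ω hω; simp [hω]),
      integral_zero, eq_comm] at h2
    exact norm_eq_zero.1 ((pow_eq_zero_iff two_ne_zero).1 h2)
  have hset : {x : E | ∫ ω, |⟪u ω, x⟫| ^ p ∂ν ≤ 1} = {x : E | ‖L x‖ ≤ 1} := by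
    ext x
    rw [mem_ofPred_eq, mem_ofPred_eq, ← hL, ← Real.rpow_le_rpow_iff (norm_nonneg _) zero_le_one hp0,
      Real.one_rpow]
  have a1 : ‖L 0‖ = 0 := by simp
  have a2 (x) : ‖L (-x)‖ = ‖L x‖ := by simp
  have a3 (x y) : ‖L (x + y)‖ ≤ ‖L x‖ + ‖L y‖ := by rw [map_add]; exact norm_add_le _ _
  have a5 (r : ℝ) (x) : ‖L (r • x)‖ ≤ |r| * ‖L x‖ := by rw [map_smul, norm_smul, Real.norm_eq_abs]
  rw [hset, measure_le_eq_lt volume (g := fun x => ‖L x‖) a1 a2 a3 h0 a5,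
    measure_lt_one_eq_integral_div_gamma volume (g := fun x => ‖L x‖) a1 a2 a3 h0 a5 hp0]
  have hG : 0 < Real.Gamma (Module.finrank ℝ E / p + 1) := Real.Gamma_pos_of_pos (by positivity)
  refine ENNReal.ofReal_le_ofReal (div_le_div_of_nonneg_right ?_ hG.le)
  have hBL := h.lintegral_exp_integral_log_le (f := fun t => Real.exp (-|t| ^ p))
    (Real.continuous_exp.comp ((continuous_abs.rpow_const fun _ => Or.inr hp0.le).neg))
    (fun _ => Real.exp_pos _)
    (Integrable.of_integral_ne_zero (by
      rw [integral_exp_neg_abs_rpow hp0]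
      have := Real.Gamma_pos_of_pos (s := 1 / p + 1) (by positivity)
      positivity))
  simp_rw [Real.log_exp, integral_neg, ← hL] at hBL
  rw [integral_exp_neg_abs_rpow hp0] at hBL
  rw [integral_eq_lintegral_of_nonneg_ae (Filter.Eventually.of_forall fun _ => (Real.exp_pos _).le)]
  · refine ENNReal.toReal_le_of_le_ofReal ?_ hBL
    have := Real.Gamma_pos_of_pos (s := 1 / p + 1) (by positivity)
    positivity
  · refine Continuous.aestronglyMeasurable ?_
    refine Real.continuous_exp.comp (Continuous.neg ?_)
    exact L.continuous_of_finiteDimensional.norm.rpow_const fun _ => Or.inr hp0.le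

theorem integral_rpow_le_one_of_norm_le (h : IsIsotropic ν u) [Nontrivial E] {p : ℝ} (hp : 1 ≤ p)
    {x : E} (hx : ‖x‖ ≤ (Module.finrank ℝ E : ℝ) ^ (1 / 2 - 1 / min p 2)) :
    ∫ ω, |⟪u ω, x⟫| ^ p ∂ν ≤ 1 := by
  have hp0 : 0 < p := by linarith
  have hfin := h.finite
  set d : ℝ := (Module.finrank ℝ E : ℝ) with hd
  have hd0 : 0 < d := Nat.cast_pos.2 Module.finrank_pos
  have hi : Integrable (fun ω => |⟪u ω, x⟫| ^ p) ν :=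
    h.integrable_comp (φ := fun v => |⟪v, x⟫| ^ p)
      (Continuous.rpow_const (by fun_prop) fun _ => Or.inr hp0.le)
  have hi2 : Integrable (fun ω => ⟪u ω, x⟫ ^ 2) ν :=
    h.integrable_comp (φ := fun v => ⟪v, x⟫ ^ 2) (by fun_prop)
  rcases le_total p 2 with hp2 | hp2
  · rw [min_eq_left hp2] at hx
    -- Young's inequality with weights `p / 2` and `1 - p / 2`. The powers of `d` cancel in the
    -- geometric mean, and after integration, as `ν` has mass `d`, the two terms are at most `p / 2`
    -- and `1 - p / 2`.
    have hpt (ω) : |⟪u ω, x⟫| ^ p ≤ (p / 2) * ⟪u ω, x⟫ ^ 2 * d ^ (2 / p - 1) + (1 - p / 2) * d⁻¹ := by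
      have h1 := Real.geom_mean_le_arith_mean2_weighted (w₁ := p / 2) (w₂ := 1 - p / 2)
        (p₁ := ⟪u ω, x⟫ ^ 2 * d ^ (2 / p - 1)) (p₂ := d⁻¹) (by positivity) (by linarith)
        (by positivity) (by positivity) (by ring)
      refine (le_of_eq ?_).trans (h1.trans (le_of_eq (by ring)))
      rw [Real.mul_rpow (sq_nonneg _) (by positivity), ← sq_abs, ← Real.rpow_natCast |_|,
        ← Real.rpow_mul (abs_nonneg _), ← Real.rpow_mul hd0.le, ← Real.rpow_neg_one d,
        ← Real.rpow_mul hd0.le, mul_assoc, ← Real.rpow_add hd0]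
      rw [show (2 / p - 1) * (p / 2) + -1 * (1 - p / 2) = 0 by field_simp; ring,
        Real.rpow_zero, mul_one]
      congr 1
      push_cast
      ring
    refine (integral_mono hi (((hi2.const_mul _).mul_const _).add (integrable_const _)) hpt).trans ?_
    simp only [Pi.add_apply]
    rw [integral_add ((hi2.const_mul _).mul_const _) (integrable_const _), integral_mul_const,
      integral_const_mul, h.integral_inner_sq, integral_const, h.measureReal_univ, smul_eq_mul,
      ← hd]
    have h2 : ‖x‖ ^ 2 ≤ d ^ (1 - 2 / p) := by
      refine (pow_le_pow_left₀ (norm_nonneg _) hx 2).trans (le_of_eq ?_)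
      rw [← Real.rpow_natCast, ← Real.rpow_mul hd0.le]
      congr 1
      push_cast
      ring
    have h3 : d ^ (1 - 2 / p) * d ^ (2 / p - 1) = 1 := by
      rw [← Real.rpow_add hd0, show 1 - 2 / p + (2 / p - 1) = 0 by ring, Real.rpow_zero]
    have h4 : ‖x‖ ^ 2 * d ^ (2 / p - 1) ≤ 1 :=
      (mul_le_mul_of_nonneg_right h2 (by positivity)).trans_eq h3
    have h5 : d * ((1 - p / 2) * d⁻¹) = 1 - p / 2 := by field_simp
    rw [h5]
    nlinarith
  · rw [min_eq_right hp2, sub_self, Real.rpow_zero] at hx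
    -- For `p ≥ 2` and `‖x‖ ≤ 1` all values `|⟪u, x⟫|` are at most one, so raising the exponent
    -- decreases them.
    have hpt : ∀ᵐ ω ∂ν, |⟪u ω, x⟫| ^ p ≤ ⟪u ω, x⟫ ^ 2 := by
      filter_upwards [h.norm_eq_one] with ω hω
      have h1 := abs_real_inner_le_norm (u ω) x
      rw [hω, one_mul] at h1
      rw [← sq_abs, ← Real.rpow_natCast]
      refine Real.rpow_le_rpow_of_exponent_ge_of_imp (abs_nonneg _) (h1.trans hx) (by simpa using hp2) ?_
      exact fun _ h2 => absurd h2 hp0.ne'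
    refine (integral_mono_ae hi hi2 hpt).trans ?_
    rw [h.integral_inner_sq]
    exact pow_le_one₀ (norm_nonneg _) hx

end IsIsotropic

end Isotropic

/-! ### The inequality for `L_p` norms on `ℝⁿ`, and auxiliary inequalities -/

theorem le_maxEllipsoidVolume {n : ℕ}
    (A : EuclideanSpace ℝ (Fin n) ≃ₗ[ℝ] EuclideanSpace ℝ (Fin n)) {r : ℝ} (hr : 0 < r)
    {C : Set (EuclideanSpace ℝ (Fin n))} (h : A '' Metric.closedBall 0 r ⊆ C) :
    ENNReal.ofReal |LinearMap.det (A : EuclideanSpace ℝ (Fin n) →ₗ[ℝ] EuclideanSpace ℝ (Fin n))| *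
      volume (Metric.closedBall (0 : EuclideanSpace ℝ (Fin n)) r) ≤ maxEllipsoidVolume C := by
  rw [← Measure.addHaar_image_linearMap]
  refine le_iSup₂_of_le (f := fun (F : Set (EuclideanSpace ℝ (Fin n)))
    (_ : IsEllipsoid F ∧ F ⊆ C) => volume F) (A '' Metric.closedBall 0 r) ⟨?_, h⟩ le_rfl
  refine ⟨((LinearEquiv.smulOfNeZero ℝ _ r hr.ne').trans A).toAffineEquiv, ?_⟩
  have h1 : Metric.closedBall (0 : EuclideanSpace ℝ (Fin n)) r =
      (fun x => r • x) '' Metric.closedBall 0 1 := by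
    rw [image_smul, smul_unitClosedBall, Real.norm_of_nonneg hr.le]
  rw [h1, image_image]
  rfl

/-- The volume of the unit ball of `ℓ_p^n`. -/
noncomputable def lpBallVolume (p : ℝ) (n : ℕ) : ℝ≥0∞ :=
  ENNReal.ofReal ((2 * Real.Gamma (1 / p + 1)) ^ n / Real.Gamma (n / p + 1))

/-- The radius of the maximal volume ellipsoid of the unit ball of `ℓ_p^n`, which is a ball. -/
noncomputable def lpInradius (p : ℝ) (n : ℕ) : ℝ := (n : ℝ) ^ (1 / 2 - 1 / min p 2)

theorem lpInradius_pos {p : ℝ} {n : ℕ} (hn : n ≠ 0) : 0 < lpInradius p n :=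
  Real.rpow_pos_of_pos (by positivity) _

/-- The volume ratio of the unit ball of the `L_p` norm `x ↦ ‖⟪f, x⟫‖_p` is bounded by the ratio of
the volume of the unit ball of `ℓ_p^n` to the volume of its inscribed Euclidean ball. -/
theorem volume_mul_volume_closedBall_le {n : ℕ} (hn : n ≠ 0) {Ω : Type*} [MeasurableSpace Ω]
    {μ : Measure Ω} {p : ℝ} (hp : 1 ≤ p) {f : Ω → EuclideanSpace ℝ (Fin n)}
    (hfm : Measurable f) (hf : MemLp f (ENNReal.ofReal p) μ)
    (hnd : ∀ x, (∀ᵐ ω ∂μ, inner ℝ (f ω) x = 0) → x = 0) :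
    volume {x | ∫ ω, |inner ℝ (f ω) x| ^ p ∂μ ≤ 1} *
        volume (Metric.closedBall (0 : EuclideanSpace ℝ (Fin n)) (lpInradius p n)) ≤
      lpBallVolume p n * maxEllipsoidVolume {x | ∫ ω, |inner ℝ (f ω) x| ^ p ∂μ ≤ 1} := by
  have : NeZero n := ⟨hn⟩
  have hE : Nontrivial (EuclideanSpace ℝ (Fin n)) := inferInstance
  obtain ⟨A, ν, u, h, hA⟩ := exists_isIsotropic_integral_inner_rpow hp hfm hf hnd
  have hK : {x | ∫ ω, |inner ℝ (f ω) x| ^ p ∂μ ≤ 1} =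
      A '' {x | ∫ ω, |inner ℝ (u ω) x| ^ p ∂ν ≤ 1} := by
    ext x
    constructor
    · intro hx
      refine ⟨A.symm x, ?_, A.apply_symm_apply x⟩
      rw [mem_ofPred_eq, ← hA, A.apply_symm_apply]
      exact hx
    · rintro ⟨y, hy, rfl⟩
      rw [mem_ofPred_eq, hA]
      exact hy
  have hb := h.volume_integral_rpow_le_one_le hp
  rw [finrank_euclideanSpace_fin] at hb
  have hsub : A '' Metric.closedBall 0 (lpInradius p n) ⊆
      A '' {x | ∫ ω, |inner ℝ (u ω) x| ^ p ∂ν ≤ 1} := by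
    refine image_mono fun x hx => h.integral_rpow_le_one_of_norm_le hp ?_
    rw [finrank_euclideanSpace_fin]
    exact mem_closedBall_zero_iff.1 hx
  rw [hK]
  -- The map `A` multiplies the volumes of body and inscribed ellipsoid by the same `|det A|`, so
  -- isotropic position costs nothing.
  calc _ = volume {x | ∫ ω, |inner ℝ (u ω) x| ^ p ∂ν ≤ 1} *
        (ENNReal.ofReal |LinearMap.det (A : EuclideanSpace ℝ (Fin n) →ₗ[ℝ] EuclideanSpace ℝ (Fin n))| *
          volume (Metric.closedBall (0 : EuclideanSpace ℝ (Fin n)) (lpInradius p n))) := by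
        have := Measure.addHaar_image_linearMap volume
          (A : EuclideanSpace ℝ (Fin n) →ₗ[ℝ] EuclideanSpace ℝ (Fin n))
          {x | ∫ ω, |inner ℝ (u ω) x| ^ p ∂ν ≤ 1}
        rw [LinearEquiv.coe_coe] at this
        rw [this]
        ring
    _ ≤ _ := mul_le_mul' hb (le_maxEllipsoidVolume A (lpInradius_pos hn) hsub)

/-- Hadamard's inequality in its trace form. -/
theorem Matrix.det_sq_le_sum_sq_div_pow {n : ℕ} (hn : n ≠ 0) (M : Matrix (Fin n) (Fin n) ℝ) :
    M.det ^ 2 ≤ ((∑ i, ∑ j, M i j ^ 2) / n) ^ n := by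
  -- The eigenvalues of `M Mᵀ` have product `det M ^ 2` and sum `∑ M i j ^ 2`; the bound is the
  -- inequality of their geometric and arithmetic means.
  have hps : (M * M.conjTranspose).PosSemidef := Matrix.posSemidef_self_mul_conjTranspose M
  have hdet : M.det ^ 2 = ∏ i, hps.1.eigenvalues i := by
    have := hps.1.det_eq_prod_eigenvalues
    rw [Matrix.det_mul, Matrix.det_conjTranspose] at this
    simpa [sq] using this
  have htr : ∑ i, ∑ j, M i j ^ 2 = ∑ i, hps.1.eigenvalues i := by
    have := hps.1.trace_eq_sum_eigenvalues
    simpa [Matrix.trace, Matrix.mul_apply, sq] using this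
  have hn' : (n : ℝ) ≠ 0 := by exact_mod_cast hn
  have h0 (i) : 0 ≤ hps.1.eigenvalues i := hps.eigenvalues_nonneg i
  have h2 := Real.geom_mean_le_arith_mean_weighted Finset.univ (fun _ => (n : ℝ)⁻¹)
    hps.1.eigenvalues (fun _ _ => by positivity) (by simp [hn']) (fun i _ => h0 i)
  rw [Real.finsetProd_rpow _ _ fun i _ => h0 i, ← Finset.mul_sum] at h2
  rw [hdet, htr]
  have h3 := pow_le_pow_left₀
    (Real.rpow_nonneg (Finset.prod_nonneg fun i _ => h0 i) _) h2 n
  rw [Real.rpow_inv_natCast_pow (Finset.prod_nonneg fun i _ => h0 i) hn] at h3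
  rwa [div_eq_inv_mul]

/-- Some choice of signs makes the norm of the signed sum at least the `ℓ_2` sum of the norms. -/
theorem exists_signs_sum_norm_sq_le {E ι : Type*} [NormedAddCommGroup E] [InnerProductSpace ℝ E]
    (s : Finset ι) (l : ι → E) :
    ∃ ε : ι → ℝ, (∀ i, |ε i| = 1) ∧ ∑ i ∈ s, ‖l i‖ ^ 2 ≤ ‖∑ i ∈ s, ε i • l i‖ ^ 2 := by
  classical
  induction s using Finset.induction_on with
  | empty => exact ⟨fun _ => 1, by simp, by simp⟩
  | insert a s ha ih =>
    obtain ⟨ε, h1, h2⟩ := ih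
    set v := ∑ i ∈ s, ε i • l i with hv
    -- The new sign makes the cross term in the expanded square nonnegative.
    obtain ⟨δ, hδ, hi⟩ : ∃ δ : ℝ, |δ| = 1 ∧ 0 ≤ δ * inner ℝ (l a) v := by
      rcases le_total 0 (inner ℝ (l a) v) with h | h
      · exact ⟨1, by simp, by simpa using h⟩
      · exact ⟨-1, by simp, by simpa using h⟩
    refine ⟨Function.update ε a δ, fun i => ?_, ?_⟩
    · rcases eq_or_ne i a with rfl | h
      · simpa using hδ
      · simpa [h] using h1 i
    · have h3 : ∑ i ∈ s, Function.update ε a δ i • l i = v :=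
        Finset.sum_congr rfl fun i hi => by
          rw [Function.update_of_ne (ne_of_mem_of_not_mem hi ha)]
      rw [Finset.sum_insert ha, Finset.sum_insert ha, h3, Function.update_self,
        norm_add_sq_real, norm_smul, Real.norm_eq_abs, hδ, one_mul, real_inner_smul_left]
      linarith

/-! ### Upper bounds for inscribed ellipsoids -/

section Ellipsoids

variable {n : ℕ}

local notation "V" => EuclideanSpace ℝ (Fin n)

theorem mul_maxEllipsoidVolume_le_image (T : V ≃ₗ[ℝ] V) (C : Set V) :
    ENNReal.ofReal |LinearMap.det (T : V →ₗ[ℝ] V)| * maxEllipsoidVolume C ≤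
      maxEllipsoidVolume (T '' C) := by
  simp only [maxEllipsoidVolume, ENNReal.mul_iSup]
  refine iSup₂_le fun F hF => ?_
  obtain ⟨⟨A, rfl⟩, hFC⟩ := hF
  rw [← Measure.addHaar_image_linearMap]
  exact le_iSup₂_of_le (T '' (A '' Metric.closedBall 0 1))
    ⟨⟨A.trans T.toAffineEquiv, by rw [image_image]; rfl⟩, image_mono hFC⟩ le_rfl

/-- An upper bound for the volume of ellipsoids in a symmetric convex set, by the Hilbert-Schmidt
norms of the linear maps which map the Euclidean ball into the set. -/
theorem maxEllipsoidVolume_le_of_sum_sq_le (hn : n ≠ 0) {C : Set V} (hconv : Convex ℝ C)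
    (hsymm : ∀ x ∈ C, -x ∈ C) {r : ℝ} (hr : 0 ≤ r)
    (hC : ∀ l : Fin n → V, (∀ x : V, ‖x‖ ≤ 1 → WithLp.toLp 2 (fun i => inner ℝ (l i) x) ∈ C) →
      ∑ i, ‖l i‖ ^ 2 ≤ n * r ^ 2) :
    maxEllipsoidVolume C ≤ volume (Metric.closedBall (0 : V) r) := by
  refine iSup₂_le fun F hF => ?_
  obtain ⟨⟨A, rfl⟩, hFC⟩ := hF
  set L : V →ₗ[ℝ] V := (A.linear : V →ₗ[ℝ] V) with hL
  have hA (x : V) : A x = L x + A 0 := by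
    have := A.map_vadd 0 x
    rw [vadd_eq_add, vadd_eq_add, add_zero] at this
    exact this
  -- The ellipsoid can be centred: `L x` is the midpoint of `A x` and `-A (-x)`.
  have hmem (x : V) (hx : ‖x‖ ≤ 1) : L x ∈ C := by
    have h1 : A x ∈ C := hFC ⟨x, by simpa using hx, rfl⟩
    have h2 : -A (-x) ∈ C := hsymm _ (hFC ⟨-x, by simpa using hx, rfl⟩)
    have h3 := hconv h1 h2 (by norm_num : (0 : ℝ) ≤ 1 / 2) (by norm_num : (0 : ℝ) ≤ 1 / 2)
      (by norm_num)
    have h4 : (1 / 2 : ℝ) • A x + (1 / 2 : ℝ) • -A (-x) = L x := by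
      rw [hA, hA (-x), map_neg]
      module
    rwa [h4] at h3
  let b := (EuclideanSpace.basisFun (Fin n) ℝ).toBasis
  set M := LinearMap.toMatrix b b L with hM
  let l : Fin n → V := fun i => WithLp.toLp 2 fun j => M i j
  have hl (x : V) : WithLp.toLp 2 (fun i => inner ℝ (l i) x) = L x := by
    ext i
    have h1 := congrFun (LinearMap.toMatrix_mulVec_repr b b L x) i
    have h2 : b.repr (L x) i = L x i := by simp [b]
    rw [h2] at h1
    rw [← h1]
    simp [l, b, Matrix.mulVec, dotProduct, PiLp.inner_apply, hM, mul_comm]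
  have h1 := hC l fun x hx => by rw [hl]; exact hmem x hx
  have h2 := M.det_sq_le_sum_sq_div_pow hn
  have h3 : ∑ i, ‖l i‖ ^ 2 = ∑ i, ∑ j, M i j ^ 2 := by
    simp [l, EuclideanSpace.norm_sq_eq]
  have hn0 : (0 : ℝ) < n := by positivity
  have h4 : |LinearMap.det L| ≤ r ^ n := by
    refine abs_le_of_sq_le_sq ?_ (by positivity)
    rw [← LinearMap.det_toMatrix b, ← hM, ← pow_mul, mul_comm n 2, pow_mul]
    refine h2.trans (pow_le_pow_left₀ (by positivity) ?_ n)
    rw [div_le_iff₀ hn0, ← h3]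
    linarith
  have h5 : A '' Metric.closedBall 0 1 = (fun y => A 0 + y) '' (L '' Metric.closedBall 0 1) := by
    rw [image_image]
    exact image_congr fun x _ => by rw [hA, add_comm]
  rw [h5, image_add_left, measure_preimage_add, Measure.addHaar_image_linearMap,
    Measure.addHaar_closedBall volume 0 hr, finrank_euclideanSpace_fin]
  refine mul_le_mul' (ENNReal.ofReal_le_ofReal h4) ?_
  have : NeZero n := ⟨hn⟩
  exact (Measure.addHaar_closedBall_eq_addHaar_ball volume (0 : V) 1).le

/-- The norm of a row `l i` is the maximum of the `i`-th coordinate on the centred ellipsoid, hence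
at most one. -/
theorem maxEllipsoidVolume_le_of_abs_le_one (hn : n ≠ 0) {C : Set V} (hconv : Convex ℝ C)
    (hsymm : ∀ x ∈ C, -x ∈ C) (hC : ∀ x ∈ C, ∀ i, |x i| ≤ 1) :
    maxEllipsoidVolume C ≤ volume (Metric.closedBall (0 : V) 1) := by
  refine maxEllipsoidVolume_le_of_sum_sq_le hn hconv hsymm zero_le_one fun l hl => ?_
  have h1 (i) : ‖l i‖ ^ 2 ≤ 1 := by
    rcases eq_or_ne (l i) 0 with h0 | h0
    · simp [h0]
    have h2 := hC _ (hl (‖l i‖⁻¹ • l i) (by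
      rw [norm_smul, norm_inv, norm_norm, inv_mul_cancel₀ (norm_ne_zero_iff.2 h0)])) i
    have h3 : ‖l i‖ ≠ 0 := norm_ne_zero_iff.2 h0
    rw [PiLp.toLp_apply, inner_smul_right, real_inner_self_eq_norm_sq, sq, ← mul_assoc,
      inv_mul_cancel₀ h3, one_mul, abs_norm] at h2
    exact pow_le_one₀ (norm_nonneg _) h2
  simpa using Finset.sum_le_sum fun i (_ : i ∈ Finset.univ) => h1 i

/-- For signs `ε`, the norm of `∑ ε i • l i` is the maximum of `∑ ε i x i` on the centred ellipsoid,
hence at most `s`. A good choice of signs makes it dominate the Hilbert-Schmidt norm. -/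
theorem maxEllipsoidVolume_le_of_sum_abs_le (hn : n ≠ 0) {C : Set V} (hconv : Convex ℝ C)
    (hsymm : ∀ x ∈ C, -x ∈ C) {r s : ℝ} (hr : 0 ≤ r) (hrs : s ^ 2 = n * r ^ 2)
    (hC : ∀ x ∈ C, ∑ i, |x i| ≤ s) :
    maxEllipsoidVolume C ≤ volume (Metric.closedBall (0 : V) r) := by
  refine maxEllipsoidVolume_le_of_sum_sq_le hn hconv hsymm hr fun l hl => ?_
  obtain ⟨ε, hε, h1⟩ := exists_signs_sum_norm_sq_le Finset.univ l
  refine h1.trans ?_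
  rw [← hrs]
  set v := ∑ i, ε i • l i with hv
  rcases eq_or_ne v 0 with h0 | h0
  · rw [h0, norm_zero, zero_pow two_ne_zero]
    exact sq_nonneg s
  have h2 := hC _ (hl (‖v‖⁻¹ • v) (by
      rw [norm_smul, norm_inv, norm_norm, inv_mul_cancel₀ (norm_ne_zero_iff.2 h0)]))
  have h3 : ‖v‖ = ∑ i, ε i * inner ℝ (l i) (‖v‖⁻¹ • v) := by
    have h4 : inner ℝ v (‖v‖⁻¹ • v) = ‖v‖ := by
      have : ‖v‖ ≠ 0 := norm_ne_zero_iff.2 h0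
      rw [inner_smul_right, real_inner_self_eq_norm_sq]
      field_simp
    conv_lhs => rw [← h4]
    conv_lhs => arg 2; rw [hv]
    rw [sum_inner]
    simp_rw [real_inner_smul_left]
  refine pow_le_pow_left₀ (norm_nonneg _) ?_ 2
  refine h3.le.trans (le_trans (Finset.sum_le_sum fun i _ => ?_) h2)
  rw [PiLp.toLp_apply]
  refine (le_abs_self _).trans ?_
  rw [abs_mul, hε, one_mul]

end Ellipsoids

/-! ### The unit ball of `ℓ_p^n` and the comparison for finite `p` -/

section Comparison

variable {n : ℕ}

local notation "V" => EuclideanSpace ℝ (Fin n)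

/-- A ball of radius `r` serves as intermediary: `h` compares `X` with the ball of `Y` over this
Euclidean ball, and `h'` says that the ellipsoids in the ball of `Y` are no larger. The product form
of `h` avoids division in `ℝ≥0∞`. -/
theorem volumeRatio_le_of_mul_le {X Y : Type*} [NormedAddCommGroup X] [NormedSpace ℝ X]
    [FiniteDimensional ℝ X] [NormedAddCommGroup Y] [NormedSpace ℝ Y] [FiniteDimensional ℝ Y]
    (e : X ≃ₗ[ℝ] V) (e' : Y ≃ₗ[ℝ] V) {r : ℝ} (hr : 0 < r)
    (h : volume (e '' Metric.closedBall 0 1) * volume (Metric.closedBall (0 : V) r) ≤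
      volume (e' '' Metric.closedBall 0 1) * maxEllipsoidVolume (e '' Metric.closedBall 0 1))
    (h' : maxEllipsoidVolume (e' '' Metric.closedBall 0 1) ≤ volume (Metric.closedBall (0 : V) r)) :
    volumeRatio X ≤ volumeRatio Y := by
  rw [volumeRatio_eq e, volumeRatio_eq e', bodyVolumeRatio, bodyVolumeRatio]
  refine ENNReal.rpow_le_rpow ?_ (by positivity)
  have h0 : volume (Metric.closedBall (0 : V) r) ≠ 0 := (Metric.measure_closedBall_pos _ _ hr).ne'
  have ht : volume (Metric.closedBall (0 : V) r) ≠ ∞ := measure_closedBall_lt_top.ne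
  refine le_trans (ENNReal.div_le_of_le_mul ?_) (ENNReal.div_le_div_left h' _)
  refine ((ENNReal.le_div_iff_mul_le (Or.inl h0) (Or.inl ht)).2 h).trans_eq ?_
  simp only [div_eq_mul_inv]
  ring

/-- The identification of `ℓ_p^n` with `ℝⁿ`. -/
noncomputable def ellPEquiv (p : ℝ≥0∞) (n : ℕ) : EllP p n ≃ₗ[ℝ] EuclideanSpace ℝ (Fin n) :=
  (WithLp.linearEquiv p ℝ (Fin n → ℝ)).trans (WithLp.linearEquiv 2 ℝ (Fin n → ℝ)).symm

theorem image_ellPEquiv_closedBall {p : ℝ≥0∞} [Fact (1 ≤ p)] (hp : p ≠ ∞) :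
    ellPEquiv p n '' Metric.closedBall 0 1 = {x : V | ∑ i, |x i| ^ p.toReal ≤ 1} := by
  have hp0 : 0 < p.toReal := ENNReal.toReal_pos (zero_lt_one.trans_le Fact.out).ne' hp
  ext x
  rw [LinearEquiv.image_eq_preimage_symm, mem_preimage, mem_closedBall_zero_iff,
    PiLp.norm_eq_sum hp0, mem_ofPred_eq]
  have h0 : 0 ≤ ∑ i, |x i| ^ p.toReal := by positivity
  rw [← Real.rpow_le_rpow_iff (z := 1 / p.toReal) h0 zero_le_one (by positivity), Real.one_rpow]
  rfl

theorem image_ellPEquiv_top_closedBall :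
    ellPEquiv ∞ n '' Metric.closedBall 0 1 = {x : V | ∀ i, |x i| ≤ 1} := by
  ext x
  rw [LinearEquiv.image_eq_preimage_symm, mem_preimage, mem_closedBall_zero_iff,
    ← PiLp.norm_ofLp, pi_norm_le_iff_of_nonneg zero_le_one]
  rfl

theorem convex_image_ellPEquiv (p : ℝ≥0∞) [Fact (1 ≤ p)] :
    Convex ℝ (ellPEquiv p n '' Metric.closedBall 0 1) :=
  (convex_closedBall 0 1).linear_image (ellPEquiv p n : EllP p n →ₗ[ℝ] V)

theorem neg_mem_image_ellPEquiv (p : ℝ≥0∞) [Fact (1 ≤ p)] (x : V)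
    (hx : x ∈ ellPEquiv p n '' Metric.closedBall 0 1) :
    -x ∈ ellPEquiv p n '' Metric.closedBall 0 1 := by
  obtain ⟨y, hy, rfl⟩ := hx
  exact ⟨-y, by simpa using hy, map_neg _ _⟩

theorem volume_sum_abs_rpow_le_one (hn : n ≠ 0) {p : ℝ} (hp : 1 ≤ p) :
    volume {x : V | ∑ i, |x i| ^ p ≤ 1} = lpBallVolume p n := by
  have : NeZero n := ⟨hn⟩
  have hp0 : 0 < p := by linarith
  have h1 := volume_sum_rpow_le (Fin n) hp 1
  rw [Fintype.card_fin, ENNReal.ofReal_one, one_pow, one_mul] at h1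
  rw [lpBallVolume, ← h1, ← (PiLp.volume_preserving_toLp (Fin n)).measure_preimage]
  · congr 1
    ext x
    have h0 : 0 ≤ ∑ i, |x i| ^ p := by positivity
    simp only [mem_preimage, mem_ofPred_eq]
    rw [← Real.rpow_le_rpow_iff (z := 1 / p) h0 zero_le_one (by positivity), Real.one_rpow]
  · refine (measurableSet_le ?_ measurable_const).nullMeasurableSet
    fun_prop

theorem volume_abs_le_one : volume {x : V | ∀ i, |x i| ≤ 1} = 2 ^ n := by
  rw [← (PiLp.volume_preserving_toLp (Fin n)).measure_preimage]
  · have : WithLp.toLp 2 ⁻¹' {x : V | ∀ i, |x i| ≤ 1} = Icc (fun _ => -1) (fun _ => 1) := by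
      ext x
      simp only [mem_preimage, mem_ofPred_eq, abs_le, mem_Icc, Pi.le_def]
      exact forall_and
    rw [this, Real.volume_Icc_pi]
    norm_num
  · refine (MeasurableSet.congr (s := ⋂ i, {x : V | |x i| ≤ 1}) ?_ ?_).nullMeasurableSet
    · exact MeasurableSet.iInter fun i => measurableSet_le (by fun_prop) measurable_const
    · ext x; simp

theorem abs_le_one_of_sum_rpow_le_one {p : ℝ} (hp : 0 < p) {x : Fin n → ℝ}
    (hx : ∑ i, |x i| ^ p ≤ 1) (i : Fin n) : |x i| ≤ 1 := by
  have h1 : |x i| ^ p ≤ 1 := (Finset.single_le_sum (f := fun i => |x i| ^ p)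
    (fun i _ => by positivity) (Finset.mem_univ i)).trans hx
  rw [← Real.one_rpow p] at h1
  exact (Real.rpow_le_rpow_iff (abs_nonneg _) zero_le_one hp).1 h1

theorem lpBallVolume_le (hn : n ≠ 0) {p : ℝ} (hp : 1 ≤ p) : lpBallVolume p n ≤ 2 ^ n := by
  rw [← volume_sum_abs_rpow_le_one hn hp, ← volume_abs_le_one]
  exact measure_mono fun x hx i => abs_le_one_of_sum_rpow_le_one (by linarith) hx i

theorem maxEllipsoidVolume_ellP_top_le (hn : n ≠ 0) :
    maxEllipsoidVolume (ellPEquiv ∞ n '' Metric.closedBall 0 1) ≤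
      volume (Metric.closedBall (0 : V) 1) := by
  refine maxEllipsoidVolume_le_of_abs_le_one hn (convex_image_ellPEquiv ∞)
    (neg_mem_image_ellPEquiv ∞) ?_
  rw [image_ellPEquiv_top_closedBall]
  exact fun x hx => hx

theorem lpInradius_of_two_le {p : ℝ} (hp : 2 ≤ p) : lpInradius p n = 1 := by
  rw [lpInradius, min_eq_right hp, sub_self, Real.rpow_zero]

/-- For `p ≤ 2`, Hölder gives `∑ |x i| ≤ n ^ (1 - 1/p)` on the unit ball, and this constant is `√n`
times the inradius. For `p ≥ 2` the ball lies in the cube, whose inradius is already one. -/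
theorem maxEllipsoidVolume_ellP_le (hn : n ≠ 0) {p : ℝ≥0∞} [Fact (1 ≤ p)] (hp : p ≠ ∞) :
    maxEllipsoidVolume (ellPEquiv p n '' Metric.closedBall 0 1) ≤
      volume (Metric.closedBall (0 : V) (lpInradius p.toReal n)) := by
  have h1 : 1 ≤ p.toReal := by
    have : (1 : ℝ≥0∞) ≤ p := Fact.out
    simpa using ENNReal.toReal_mono hp this
  have h0 : 0 < p.toReal := by linarith
  have hn0 : (0 : ℝ) < n := by positivity
  rcases le_total p.toReal 2 with h2 | h2
  · refine maxEllipsoidVolume_le_of_sum_abs_le hn (convex_image_ellPEquiv p)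
      (neg_mem_image_ellPEquiv p) (lpInradius_pos hn).le
      (s := (n : ℝ) ^ ((p.toReal - 1) / p.toReal)) ?_ ?_
    · rw [lpInradius, min_eq_left h2, ← Real.rpow_natCast, ← Real.rpow_natCast,
        ← Real.rpow_mul hn0.le, ← Real.rpow_mul hn0.le]
      rw [mul_comm (n : ℝ), ← Real.rpow_add_one hn0.ne']
      congr 1
      push_cast
      field_simp
      ring
    · rw [image_ellPEquiv_closedBall hp]
      intro x hx
      have h3 := Real.rpow_sum_le_const_mul_sum_rpow Finset.univ (fun i => x i) h1
      rw [← Real.rpow_le_rpow_iff (Finset.sum_nonneg fun i _ => abs_nonneg _) (by positivity) h0,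
        ← Real.rpow_mul hn0.le, div_mul_cancel₀ _ h0.ne']
      refine h3.trans ?_
      rw [Finset.card_univ, Fintype.card_fin]
      exact mul_le_of_le_one_right (by positivity) hx
  · rw [lpInradius_of_two_le h2]
    refine maxEllipsoidVolume_le_of_abs_le_one hn (convex_image_ellPEquiv p)
      (neg_mem_image_ellPEquiv p) ?_
    rw [image_ellPEquiv_closedBall hp]
    exact fun x hx i => abs_le_one_of_sum_rpow_le_one h0 hx i

end Comparison

/-- The comparison of volume ratios for subspaces of `L_p`, `p < ∞`. -/
theorem volumeRatio_le_of_submodule_Lp {n : ℕ} (hn : n ≠ 0) {p : ℝ} (hp : 1 ≤ p)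
    [Fact (1 ≤ ENNReal.ofReal p)] {Ω : Type*} [MeasurableSpace Ω] {μ : Measure Ω}
    (X : Submodule ℝ (Lp ℝ (ENNReal.ofReal p) μ)) [FiniteDimensional ℝ X]
    (hX : Module.finrank ℝ X = n) :
    volumeRatio X ≤ volumeRatio (EllP (ENNReal.ofReal p) n) := by
  have hp0 : 0 < p := by linarith
  let b : Module.Basis (Fin n) ℝ X := Module.finBasisOfFinrankEq ℝ X hX
  let e : X ≃ₗ[ℝ] EuclideanSpace ℝ (Fin n) :=
    b.equivFun.trans (WithLp.linearEquiv 2 ℝ (Fin n → ℝ)).symm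
  -- The components of `f` represent a basis of `X`, so `⟪f, x⟫` is the element of `X` with
  -- coordinates `x`.
  let f : Ω → EuclideanSpace ℝ (Fin n) := fun ω =>
    WithLp.toLp 2 fun i => (b i : Lp ℝ (ENNReal.ofReal p) μ) ω
  have hfm : Measurable f := by
    refine (WithLp.measurable_toLp 2 _).comp (measurable_pi_lambda _ fun i => ?_)
    exact (Lp.stronglyMeasurable _).measurable
  have hf : MemLp f (ENNReal.ofReal p) μ := by
    refine MemLp.of_eval_piLp fun i => ?_
    exact Lp.memLp (b i : Lp ℝ (ENNReal.ofReal p) μ)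
  have he (x) : ((e.symm x : X) : Lp ℝ (ENNReal.ofReal p) μ) =ᵐ[μ] fun ω => inner ℝ (f ω) x := by
    have h1 : ((e.symm x : X) : Lp ℝ (ENNReal.ofReal p) μ) =
        ∑ i, x i • (b i : Lp ℝ (ENNReal.ofReal p) μ) := by
      have : e.symm x = ∑ i, x i • b i := b.equivFun_symm_apply _
      rw [this]
      simp
    rw [h1]
    have h2 : ∀ᵐ ω ∂μ, ∀ i, (x i • (b i : Lp ℝ (ENNReal.ofReal p) μ)) ω =
        x i * (b i : Lp ℝ (ENNReal.ofReal p) μ) ω := ae_all_iff.2 fun i => Lp.coeFn_smul _ _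
    filter_upwards [h2, Lp.coeFn_finsetSum Finset.univ
      fun i => x i • (b i : Lp ℝ (ENNReal.ofReal p) μ)] with ω h3 h4
    rw [h4, Finset.sum_apply, PiLp.inner_apply]
    exact Finset.sum_congr rfl fun i _ => h3 i
  have hmem (x) : MemLp (fun ω => inner ℝ (f ω) x) (ENNReal.ofReal p) μ :=
    (Lp.memLp _).ae_eq (he x)
  have hnorm (x) : ‖e.symm x‖ ^ p = ∫ ω, |inner ℝ (f ω) x| ^ p ∂μ := by
    have h1 := norm_toLp_rpow hp0 (hmem x)
    have h2 : (hmem x).toLp _ = ((e.symm x : X) : Lp ℝ (ENNReal.ofReal p) μ) :=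
      Lp.ext ((hmem x).coeFn_toLp.trans (he x).symm)
    rw [h2] at h1
    exact h1
  have himage : e '' Metric.closedBall 0 1 = {x | ∫ ω, |inner ℝ (f ω) x| ^ p ∂μ ≤ 1} := by
    ext x
    rw [LinearEquiv.image_eq_preimage_symm, mem_preimage, mem_closedBall_zero_iff, mem_ofPred_eq,
      ← hnorm, ← Real.rpow_le_rpow_iff (norm_nonneg _) zero_le_one hp0, Real.one_rpow]
  have hnd (x) (hx : ∀ᵐ ω ∂μ, inner ℝ (f ω) x = 0) : x = 0 := by
    have h1 : ((e.symm x : X) : Lp ℝ (ENNReal.ofReal p) μ) = 0 := by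
      refine Lp.ext ?_
      filter_upwards [he x, hx, Lp.coeFn_zero ℝ (ENNReal.ofReal p) μ] with ω h1 h2 h3
      rw [h1, h2, h3, Pi.zero_apply]
    simpa using h1
  refine volumeRatio_le_of_mul_le e (ellPEquiv _ n) (lpInradius_pos (p := p) hn) ?_ ?_
  · have h1 := volume_mul_volume_closedBall_le hn hp hfm hf hnd
    rw [image_ellPEquiv_closedBall ENNReal.ofReal_ne_top, ENNReal.toReal_ofReal hp0.le,
      volume_sum_abs_rpow_le_one hn hp, himage]
    exact h1
  · have h1 := maxEllipsoidVolume_ellP_le hn (p := ENNReal.ofReal p) ENNReal.ofReal_ne_top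
    rwa [ENNReal.toReal_ofReal hp0.le] at h1

/-! ### The case `p = ∞` -/

section SupNorm

open Filter Topology

/-- Finitely many functionals of norm at most one compute the norm up to the factor `θ < 1`. -/
theorem exists_finset_norming {X : Type*} [NormedAddCommGroup X] [NormedSpace ℝ X]
    [FiniteDimensional ℝ X] {θ : ℝ} (hθ : θ < 1) :
    ∃ t : Finset (StrongDual ℝ X), (∀ φ ∈ t, ‖φ‖ ≤ 1) ∧ ∀ z, z ≠ 0 → ∃ φ ∈ t, θ * ‖z‖ ≤ |φ z| := by
  classical
  have h1 (x : X) : ∃ φ : StrongDual ℝ X, ‖φ‖ ≤ 1 ∧ φ x = ‖x‖ := by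
    obtain ⟨φ, h1, h2⟩ := exists_dual_vector'' ℝ x
    exact ⟨φ, h1, by simpa using h2⟩
  choose φ hφ1 hφ2 using h1
  -- A norming functional at `x` exceeds `θ` near `x`; compactness of the sphere leaves finitely
  -- many.
  obtain ⟨t, -, ht⟩ := (isCompact_sphere (0 : X) 1).elim_nhds_subcover
    (fun x => {y | θ < φ x y}) fun x hx => by
      refine (φ x).continuous.continuousAt.eventually_const_lt ?_
      rw [hφ2, mem_sphere_zero_iff_norm.1 hx]
      exact hθ
  refine ⟨t.image φ, fun ψ hψ => ?_, fun z hz => ?_⟩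
  · obtain ⟨x, -, rfl⟩ := Finset.mem_image.1 hψ
    exact hφ1 x
  · have hz0 : 0 < ‖z‖ := norm_pos_iff.2 hz
    have h2 : ‖z‖⁻¹ • z ∈ Metric.sphere (0 : X) 1 := by
      rw [mem_sphere_zero_iff_norm, norm_smul, norm_inv, norm_norm, inv_mul_cancel₀ hz0.ne']
    obtain ⟨x, hx, h3⟩ := mem_iUnion₂.1 (ht h2)
    refine ⟨φ x, Finset.mem_image_of_mem _ hx, ?_⟩
    have h4 : θ < φ x (‖z‖⁻¹ • z) := h3
    rw [map_smul, smul_eq_mul, lt_inv_mul_iff₀ hz0] at h4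
    rw [mul_comm]
    exact h4.le.trans (le_abs_self _)

/-- The norm of `X` is approximated by the `ℓ_p^m` norm of `m` norming functionals, with unit ball
`K`. If `m θ ^ p ≤ 1` then `θ C ⊆ K` and `θ K ⊆ C`; each inclusion costs a factor `θ ^ n`, and the
finite case is applied to `K`. -/
theorem pow_mul_volume_mul_volume_closedBall_le {n : ℕ} (hn : n ≠ 0) {X : Type*}
    [NormedAddCommGroup X] [NormedSpace ℝ X] [FiniteDimensional ℝ X]
    (e : X ≃ₗ[ℝ] EuclideanSpace ℝ (Fin n)) {θ : ℝ} (hθ0 : 0 < θ) (hθ : θ < 1) :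
    ENNReal.ofReal (θ ^ (2 * n)) * (volume (e '' Metric.closedBall 0 1) *
      volume (Metric.closedBall (0 : EuclideanSpace ℝ (Fin n)) 1)) ≤
    2 ^ n * maxEllipsoidVolume (e '' Metric.closedBall 0 1) := by
  obtain ⟨t, ht1, ht2⟩ := exists_finset_norming (X := X) hθ
  set m := t.card
  obtain ⟨k, hk⟩ : ∃ k : ℕ, m * θ ^ k ≤ 1 := by
    have h1 : Tendsto (fun k : ℕ => m * θ ^ k) atTop (𝓝 (m * 0)) :=
      (tendsto_pow_atTop_nhds_zero_of_lt_one hθ0.le hθ).const_mul _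
    rw [mul_zero] at h1
    exact (h1.eventually (ge_mem_nhds one_pos)).exists
  -- Adding two ensures `p ≥ 2`, so that the comparison ball has radius exactly one.
  set p : ℝ := k + 2 with hpdef
  have hp2 : 2 ≤ p := by simp [hpdef]
  have hp1 : 1 ≤ p := by linarith
  have hp0 : 0 < p := by linarith
  have hmp : m * θ ^ p ≤ 1 := by
    refine le_trans (mul_le_mul_of_nonneg_left ?_ (Nat.cast_nonneg _)) hk
    rw [← Real.rpow_natCast]
    exact Real.rpow_le_rpow_of_exponent_ge hθ0 hθ.le (by simp [hpdef])
  let φ : Fin m → StrongDual ℝ X := fun i => (t.equivFin.symm i : StrongDual ℝ X)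
  have hφ (i) : ‖φ i‖ ≤ 1 := ht1 _ (t.equivFin.symm i).2
  have hφ' (z : X) (hz : z ≠ 0) : ∃ i, θ * ‖z‖ ≤ |φ i z| := by
    obtain ⟨ψ, hψ, h⟩ := ht2 z hz
    exact ⟨t.equivFin ⟨ψ, hψ⟩, by simpa [φ] using h⟩
  let f : Fin m → EuclideanSpace ℝ (Fin n) := fun i =>
    (InnerProductSpace.toDual ℝ _).symm ((φ i).comp (e.symm.toContinuousLinearEquiv :
      EuclideanSpace ℝ (Fin n) →L[ℝ] X))
  have hf (i) (x) : inner ℝ (f i) x = φ i (e.symm x) := by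
    simp [f]
  have hint (x) : ∫ i, |inner ℝ (f i) x| ^ p ∂Measure.count = ∑ i, |φ i (e.symm x)| ^ p := by
    rw [integral_count]
    simp_rw [hf]
  have hcore := volume_mul_volume_closedBall_le hn (μ := Measure.count) hp1 (f := f)
    (measurable_of_finite _) (by
      refine MemLp.of_bound (measurable_of_finite _).aestronglyMeasurable
        (∑ i, ‖f i‖) (Eventually.of_forall fun i => ?_)
      exact Finset.single_le_sum (f := fun i => ‖f i‖) (fun _ _ => norm_nonneg _)
        (Finset.mem_univ i))
    (fun x hx => by
      by_contra hx0
      obtain ⟨i, hi⟩ := hφ' (e.symm x) (by simpa using hx0)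
      have h1 : inner ℝ (f i) x = 0 := by
        have := ae_iff_of_countable.1 hx i
        simpa using this
      rw [hf] at h1
      rw [h1, abs_zero] at hi
      have : 0 < ‖e.symm x‖ := norm_pos_iff.2 (by simpa using hx0)
      nlinarith)
  simp_rw [hint] at hcore
  rw [lpInradius_of_two_le hp2] at hcore
  set K := {x : EuclideanSpace ℝ (Fin n) | ∑ i, |φ i (e.symm x)| ^ p ≤ 1} with hK
  set C := e '' Metric.closedBall 0 1 with hC
  let T : EuclideanSpace ℝ (Fin n) ≃ₗ[ℝ] EuclideanSpace ℝ (Fin n) :=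
    LinearEquiv.smulOfNeZero ℝ _ θ hθ0.ne'
  have hTdet : LinearMap.det (T : EuclideanSpace ℝ (Fin n) →ₗ[ℝ] EuclideanSpace ℝ (Fin n)) =
      θ ^ n := by
    have : (T : EuclideanSpace ℝ (Fin n) →ₗ[ℝ] EuclideanSpace ℝ (Fin n)) =
      θ • LinearMap.id := rfl
    rw [this, LinearMap.det_smul, LinearMap.det_id, mul_one, finrank_euclideanSpace_fin]
  have hmemC (x) : x ∈ C ↔ ‖e.symm x‖ ≤ 1 := by
    rw [hC, LinearEquiv.image_eq_preimage_symm, mem_preimage, mem_closedBall_zero_iff]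
  have hsub1 : T '' C ⊆ K := by
    rintro _ ⟨x, hx, rfl⟩
    rw [hmemC] at hx
    have h1 (i) : |φ i (e.symm (T x))| ^ p ≤ θ ^ p := by
      refine Real.rpow_le_rpow (abs_nonneg _) ?_ hp0.le
      have h2 : e.symm (T x) = θ • e.symm x := e.symm.map_smul θ x
      rw [h2, map_smul, smul_eq_mul, abs_mul, abs_of_pos hθ0]
      refine mul_le_of_le_one_right hθ0.le ?_
      exact ((φ i).le_opNorm _).trans (mul_le_one₀ (hφ i) (norm_nonneg _) hx)
    rw [hK, mem_ofPred_eq]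
    refine (Finset.sum_le_sum fun i _ => h1 i).trans ?_
    simpa using hmp
  have hsub2 : T '' K ⊆ C := by
    rintro _ ⟨x, hx, rfl⟩
    rw [hmemC]
    have h2 : e.symm (T x) = θ • e.symm x := e.symm.map_smul θ x
    rw [h2, norm_smul, Real.norm_of_nonneg hθ0.le]
    rcases eq_or_ne (e.symm x) 0 with h0 | h0
    · rw [h0, norm_zero, mul_zero]
      exact zero_le_one
    · obtain ⟨i, hi⟩ := hφ' _ h0
      exact hi.trans (abs_le_one_of_sum_rpow_le_one hp0 (x := fun i => φ i (e.symm x)) hx i)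
  have hv : ENNReal.ofReal (θ ^ n) * volume C ≤ volume K := by
    have h1 := Measure.addHaar_image_linearMap volume
      (T : EuclideanSpace ℝ (Fin n) →ₗ[ℝ] EuclideanSpace ℝ (Fin n)) C
    rw [LinearEquiv.coe_coe, hTdet, abs_of_pos (by positivity)] at h1
    rw [← h1]
    exact measure_mono hsub1
  have hm : ENNReal.ofReal (θ ^ n) * maxEllipsoidVolume K ≤ maxEllipsoidVolume C := by
    have h1 := mul_maxEllipsoidVolume_le_image T K
    rw [hTdet, abs_of_pos (by positivity)] at h1
    exact h1.trans (iSup₂_le fun F hF => le_iSup₂_of_le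
      (f := fun (F : Set (EuclideanSpace ℝ (Fin n))) (_ : IsEllipsoid F ∧ F ⊆ C) => volume F)
      F ⟨hF.1, hF.2.trans hsub2⟩ le_rfl)
  set B := volume (Metric.closedBall (0 : EuclideanSpace ℝ (Fin n)) 1)
  have hθn : ENNReal.ofReal (θ ^ (2 * n)) = ENNReal.ofReal (θ ^ n) * ENNReal.ofReal (θ ^ n) := by
    rw [← ENNReal.ofReal_mul (by positivity), ← pow_add, two_mul]
  calc ENNReal.ofReal (θ ^ (2 * n)) * (volume C * B)
      = ENNReal.ofReal (θ ^ n) * ((ENNReal.ofReal (θ ^ n) * volume C) * B) := by rw [hθn]; ring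
    _ ≤ ENNReal.ofReal (θ ^ n) * (volume K * B) := by gcongr
    _ ≤ ENNReal.ofReal (θ ^ n) * (2 ^ n * maxEllipsoidVolume K) :=
        mul_le_mul' le_rfl (hcore.trans (mul_le_mul' (lpBallVolume_le hn hp1) le_rfl))
    _ = 2 ^ n * (ENNReal.ofReal (θ ^ n) * maxEllipsoidVolume K) := by ring
    _ ≤ 2 ^ n * maxEllipsoidVolume C := by gcongr

/-- Among `n`-dimensional normed spaces, `ℓ_∞^n` has maximal volume ratio. -/
theorem volumeRatio_le_ellP_top {n : ℕ} (hn : n ≠ 0) (X : Type*) [NormedAddCommGroup X]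
    [NormedSpace ℝ X] [FiniteDimensional ℝ X] (hX : Module.finrank ℝ X = n) :
    volumeRatio X ≤ volumeRatio (EllP ∞ n) := by
  let e : X ≃ₗ[ℝ] EuclideanSpace ℝ (Fin n) := LinearEquiv.ofFinrankEq _ _ (by simpa using hX)
  refine volumeRatio_le_of_mul_le e (ellPEquiv ∞ n) one_pos ?_ (maxEllipsoidVolume_ellP_top_le hn)
  rw [image_ellPEquiv_top_closedBall, volume_abs_le_one]
  -- The approximate inequality holds for every `θ` in `(0, 1)` and its right side does not depend
  -- on `θ`.
  have ht : Tendsto (fun θ : ℝ => ENNReal.ofReal (θ ^ (2 * n)) *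
      (volume (e '' Metric.closedBall 0 1) *
        volume (Metric.closedBall (0 : EuclideanSpace ℝ (Fin n)) 1))) (𝓝[<] 1)
      (𝓝 (ENNReal.ofReal (1 ^ (2 * n)) * (volume (e '' Metric.closedBall 0 1) *
        volume (Metric.closedBall (0 : EuclideanSpace ℝ (Fin n)) 1)))) := by
    refine ENNReal.Tendsto.mul_const ?_ (Or.inl (by simp))
    refine (ENNReal.continuous_ofReal.comp (continuous_pow _)).continuousAt.tendsto.mono_left
      nhdsWithin_le_nhds
  rw [one_pow, ENNReal.ofReal_one, one_mul] at ht
  refine le_of_tendsto ht ?_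
  filter_upwards [Ioo_mem_nhdsLT (zero_lt_one' ℝ)] with θ hθ
  exact pow_mul_volume_mul_volume_closedBall_le hn e hθ.1 hθ.2

end SupNorm

/-! ### The copy of `ℓ_p^n` in `L_p[0,1]` -/

theorem eLpNorm_count_eq_enorm_toLp {p : ℝ≥0∞} [Fact (1 ≤ p)] {n : ℕ} (a : EllP p n) :
    eLpNorm (fun i => a i) p Measure.count = ‖a‖ₑ := by
  have hp1 : (1 : ℝ≥0∞) ≤ p := Fact.out
  have hp0 : p ≠ 0 := (zero_lt_one.trans_le hp1).ne'
  rcases eq_or_ne p ∞ with rfl | hp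
  · rw [eLpNorm_exponent_top, eLpNormEssSup, essSup_count, enorm_eq_nnnorm, PiLp.nnnorm_eq_ciSup,
      ENNReal.coe_iSup (Finite.bddAbove_range _)]
    rfl
  · have hpr : 0 < p.toReal := ENNReal.toReal_pos hp0 hp
    rw [eLpNorm_eq_lintegral_rpow_enorm_toReal hp0 hp, lintegral_count, tsum_fintype,
      enorm_eq_nnnorm, PiLp.nnnorm_eq_sum hp, ENNReal.coe_rpow_of_nonneg _ (by positivity),
      ENNReal.ofNNReal_finsetSum]
    congr 2
    funext i
    rw [ENNReal.coe_rpow_of_nonneg _ hpr.le]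
    rfl

/-- A measure preserving map from the unit interval to the uniform measure on `n` points. -/
theorem exists_measurePreserving_fin {n : ℕ} (hn : n ≠ 0) :
    ∃ k : ℝ → Fin n, MeasurePreserving k (volume.restrict (Icc (0 : ℝ) 1))
      ((n : ℝ≥0∞)⁻¹ • Measure.count) := by
  have hn0 : (0 : ℝ) < n := by positivity
  -- The index of the interval of length `1 / n` containing `t`. On `[0, 1)` the remainder modulo
  -- `n` changes nothing; it only makes `k` total, and the endpoint `1` is null.
  let k : ℝ → Fin n := fun t => ⟨⌊n * t⌋₊ % n, Nat.mod_lt _ (Nat.pos_of_ne_zero hn)⟩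
  have hk : Measurable k := by
    refine (measurable_of_finite (fun m : Fin n => m)).comp ?_
    exact (measurable_from_nat (f := fun m : ℕ =>
      (⟨m % n, Nat.mod_lt _ (Nat.pos_of_ne_zero hn)⟩ : Fin n))).comp
      (Nat.measurable_floor.comp (measurable_const_mul _))
  refine ⟨k, hk, Measure.ext_of_singleton fun i => ?_⟩
  rw [Measure.map_apply hk (measurableSet_singleton i), ← restrict_Ico_eq_restrict_Icc,
    Measure.restrict_apply (hk (measurableSet_singleton i))]
  have hset : k ⁻¹' {i} ∩ Ico 0 1 = Ico ((i : ℝ) / n) ((i + 1) / n) := by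
    ext t
    simp only [mem_inter_iff, mem_preimage, mem_singleton_iff, mem_Ico, k, Fin.ext_iff]
    rw [div_le_iff₀ hn0, lt_div_iff₀ hn0]
    have hi : (i : ℝ) + 1 ≤ n := by exact_mod_cast i.2
    constructor
    · rintro ⟨h1, h2, h3⟩
      have h4 : 0 ≤ n * t := by positivity
      have h5 : ⌊n * t⌋₊ < n := (Nat.floor_lt h4).2 (by nlinarith)
      rw [Nat.mod_eq_of_lt h5, Nat.floor_eq_iff h4] at h1
      constructor <;> linarith
    · rintro ⟨h1, h2⟩
      have hi0 : (0 : ℝ) ≤ i := Nat.cast_nonneg _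
      have h4 : 0 ≤ n * t := by linarith
      refine ⟨?_, ?_, ?_⟩
      · have h5 : ⌊n * t⌋₊ = i := (Nat.floor_eq_iff h4).2 ⟨by linarith, by linarith⟩
        rw [h5, Nat.mod_eq_of_lt i.2]
      · exact nonneg_of_mul_nonneg_right h4 hn0
      · by_contra! h6
        nlinarith
  rw [hset, Real.volume_Ico, Measure.smul_apply, Measure.count_singleton, smul_eq_mul, mul_one,
    ← sub_div, add_sub_cancel_left, one_div, ENNReal.ofReal_inv_of_pos hn0, ENNReal.ofReal_natCast]

/-- `ℓ_p^n` embeds isometrically in `L_p[0,1]`. -/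
theorem exists_submodule_Lp_linearIsometryEquiv (p : ℝ≥0∞) [Fact (1 ≤ p)] {n : ℕ} (hn : n ≠ 0) :
    ∃ X : Submodule ℝ (Lp ℝ p (volume.restrict (Icc (0 : ℝ) 1))),
      Nonempty (X ≃ₗᵢ[ℝ] EllP p n) := by
  obtain ⟨k, hk⟩ := exists_measurePreserving_fin hn
  -- The factor `n ^ (1/p)` compensates the mass `1 / n` of each interval; for `p = ∞` it is one.
  set s : ℝ := (1 / p).toReal with hs
  set c : ℝ := (n : ℝ) ^ s with hc
  have hc0 : 0 ≤ c := Real.rpow_nonneg (Nat.cast_nonneg _) _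
  have hnorm (a : EllP p n) : eLpNorm (fun t => c * a (k t)) p (volume.restrict (Icc (0 : ℝ) 1)) =
      ‖a‖ₑ := by
    have h1 : (fun t => c * a (k t)) = c • ((fun i => a i) ∘ k) := rfl
    rw [h1, eLpNorm_const_smul, eLpNorm_comp_measurePreserving
      (measurable_of_finite _).aestronglyMeasurable hk, eLpNorm_smul_measure_of_ne_zero (by simp),
      eLpNorm_count_eq_enorm_toLp, smul_eq_mul, ← mul_assoc, Real.enorm_of_nonneg hc0, hc,
      ← ENNReal.ofReal_rpow_of_nonneg (Nat.cast_nonneg _) ENNReal.toReal_nonneg,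
      ENNReal.ofReal_natCast, ← hs, ENNReal.inv_rpow, ENNReal.mul_inv_cancel, one_mul]
    · simp [hn]
    · exact ENNReal.rpow_ne_top_of_nonneg ENNReal.toReal_nonneg (by simp)
  have hmem (a : EllP p n) : MemLp (fun t => c * a (k t)) p (volume.restrict (Icc (0 : ℝ) 1)) :=
    ⟨(((measurable_of_finite fun i => a i).comp hk.measurable).const_mul c).aestronglyMeasurable,
      by rw [hnorm]; exact enorm_lt_top⟩
  let Φ : EllP p n →ₗᵢ[ℝ] Lp ℝ p (volume.restrict (Icc (0 : ℝ) 1)) :=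
    { toFun := fun a => (hmem a).toLp _
      map_add' := fun a b => by
        rw [← MemLp.toLp_add]
        congr 1
        funext t
        exact mul_add _ _ _
      map_smul' := fun r a => by
        rw [RingHom.id_apply, ← MemLp.toLp_const_smul]
        congr 1
        funext t
        exact mul_left_comm _ _ _
      norm_map' := fun a => by
        change ‖(hmem a).toLp _‖ = ‖a‖
        rw [Lp.norm_toLp, hnorm, toReal_enorm] }
  exact ⟨LinearMap.range Φ.toLinearMap, ⟨Φ.equivRange.symm⟩⟩

/-! ### Dimension zero and the conclusion -/

/-- The exponent `1 / 0` is zero by convention, so the power is one whatever its base. -/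
theorem volumeRatio_of_finrank_eq_zero (X : Type*) [NormedAddCommGroup X] [NormedSpace ℝ X]
    [FiniteDimensional ℝ X] (hX : Module.finrank ℝ X = 0) : volumeRatio X = 1 := by
  have h : 1 / (Module.finrank ℝ X : ℝ) = 0 := by rw [hX, Nat.cast_zero, div_zero]
  rw [volumeRatio, bodyVolumeRatio, h, ENNReal.rpow_zero]

theorem theorem6 (p : ℝ≥0∞) [Fact (1 ≤ p)] (n : ℕ) :
    (∀ (Ω : Type*) [MeasurableSpace Ω] (μ : Measure Ω) (X : Submodule ℝ (Lp ℝ p μ))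
      [FiniteDimensional ℝ X], Module.finrank ℝ X = n → volumeRatio X ≤ volumeRatio (EllP p n)) ∧
    ∃ X : Submodule ℝ (Lp ℝ p (volume.restrict (Icc (0 : ℝ) 1))),
      Nonempty (X ≃ₗᵢ[ℝ] EllP p n) := by
  rcases eq_or_ne n 0 with rfl | hn
  · refine ⟨fun Ω _ μ X _ hX => ?_, ⊥, ⟨⟨0, fun x => ?_⟩⟩⟩
    · rw [volumeRatio_of_finrank_eq_zero X hX, volumeRatio_of_finrank_eq_zero _
        Module.finrank_zero_of_subsingleton]
    · rw [Subsingleton.elim x 0]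
      simp
  refine ⟨fun Ω _ μ X _ hX => ?_, exists_submodule_Lp_linearIsometryEquiv p hn⟩
  rcases eq_or_ne p ∞ with rfl | hp
  · exact volumeRatio_le_ellP_top hn X hX
  · have h1 : 1 ≤ p.toReal := by
      have : (1 : ℝ≥0∞) ≤ p := Fact.out
      simpa using ENNReal.toReal_mono hp this
    obtain ⟨q, hq, rfl⟩ : ∃ q : ℝ, 1 ≤ q ∧ p = ENNReal.ofReal q :=
      ⟨p.toReal, h1, (ENNReal.ofReal_toReal hp).symm⟩
    exact volumeRatio_le_of_submodule_Lp hn hq X hX
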